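/- Let $a,b>-1$ and $c>0$. For $N\ge 1$ and $\beta>0$ the beta Jacobi ensemble is the probability distribution of points $x_1,\dots,x_N\in[0,1]$ with joint density proportional to $\prod_{i<j}|x_j-x_i|^{\beta}\prod_{l=1}^N x_l^a(1-x_l)^b$, and $L_{N,\beta}=\frac1N\sum_{i=1}^N\delta_{x_i}$ is its empirical distribution. Let $\nu_c$ be the limiting measure of these ensembles in the high temperature regime, that is, the probability measure on $\mathbb R$ to which $L_{N,\beta}$ converges weakly, in probability, whenever $N\to\infty$ and $\beta N\to 2c$: for every bounded continuous $f$ and every $\varepsilon>0$, $\mathbb P(|\langle L_{N,\beta},f\rangle-\langle \nu_c,f\rangle|\ge\varepsilon)\to0$. Here $\langle\mu,f\rangle=\int f\,d\mu$. Put $$\hat\lambda_0=\frac{c+a+1}{2c+a+b+2},\qquad \mu_1=\frac{1+c}{2c+a+b+3}\cdot\frac{1+c+b}{2c+a+b+2},$$ and, for $n\ge0$, $$\lambda_n^*=\frac{n+c+a+1}{2n+2c+a+b+2}\cdot\frac{n+c+a+b+2}{2n+2c+a+b+3},\qquad \mu_n^*=\frac{n+c+1}{2n+2c+a+b+3}\cdot\frac{n+c+b+2}{2n+2c+a+b+4}.$$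 Let $J_c^*$ be the infinite symmetric tridiagonal matrix with diagonal entries $a^*_{n}=\lambda_{n-1}^*+\mu_{n-1}^*$ and off-diagonal entries $b^*_n=\sqrt{\mu_{n-1}^*\lambda_{n}^*}$, $n\ge1$. Then the measure $\nu_c$ exists, is unique and is supported on $[0,1]$; the number $Z_c^*=\langle\nu_c,x(1-x)\rangle$ is positive and $$Z_c^*=\hat\lambda_0(1-\hat\lambda_0-\mu_1);$$ and $J_c^*$ is the Jacobi matrix of the probability measure $\nu_c^*(dx)=(Z_c^*)^{-1}x(1-x)\,\nu_c(dx)$. The last statement means that all $b_n^*$ are positive, that $\nu_c^*$ has finite moments of all orders and infinite support, and that its monic orthogonal polynomials $p_n$ satisfy $p_0=1$, $p_1=x-a_1^*$ and $p_{n+1}=xp_n-a_{n+1}^*p_n-(b_n^*)^2p_{n-1}$ for $n\ge1$. -/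

import Mathlib

namespace BetaJacobi

open MeasureTheory Filter Topology

noncomputable section

/-! ### Beta Jacobi ensembles and their limiting measure -/

/-- The unnormalised density `∏_{i<j} |x_j - x_i|^β ∏_l x_l^a (1 - x_l)^b`. -/
def weight (N : ℕ) (β a b : ℝ) (x : Fin N → ℝ) : ℝ :=
  (∏ i, ∏ j ∈ Finset.Ioi i, |x j - x i| ^ β) * ∏ l, (x l ^ a * (1 - x l) ^ b)

/-- The measure on the cube `[0,1]^N` with the above density. -/
def weightMeasure (N : ℕ) (β a b : ℝ) : Measure (Fin N → ℝ) :=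
  ((volume : Measure (Fin N → ℝ)).restrict (Set.univ.pi fun _ => Set.Icc 0 1)).withDensity
    fun x => ENNReal.ofReal (weight N β a b x)

/-- The beta Jacobi ensemble: the law on `[0,1]^N` of the points, in exchangeable order. -/
def ensemble (N : ℕ) (β a b : ℝ) : Measure (Fin N → ℝ) :=
  (weightMeasure N β a b Set.univ)⁻¹ • weightMeasure N β a b

/-- The empirical distribution `N⁻¹ ∑ δ_{x_i}` of the points `x_1, …, x_N`. -/
def empiricalMeasure {N : ℕ} (x : Fin N → ℝ) : Measure ℝ :=
  (N : ENNReal)⁻¹ • ∑ i, Measure.dirac (x i)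

/-- `ν` is the limiting measure of the beta Jacobi ensembles in the high temperature regime
`N → ∞`, `β N → 2c`: the empirical distributions converge weakly to `ν` in probability. -/
def IsLimitingMeasure (a b c : ℝ) (ν : Measure ℝ) : Prop :=
  ∀ β : ℕ → ℝ, (∀ N, 0 < β N) → Tendsto (fun N : ℕ => β N * (N : ℝ)) atTop (𝓝 (2 * c)) →
    ∀ f : BoundedContinuousFunction ℝ ℝ, ∀ ε : ℝ, 0 < ε →
      Tendsto
        (fun N : ℕ => ensemble N (β N) a b
          {x | ε ≤ |(∫ y, f y ∂(empiricalMeasure x)) - ∫ y, f y ∂ν|})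
        atTop (𝓝 0)

/-! ### Jacobi matrices of measures -/

/-- The infinite symmetric tridiagonal matrix with diagonal `α 0, α 1, …` and off-diagonal
`β 0, β 1, …` (indices start at `0`). -/
def jacobiMatrix (α β : ℕ → ℝ) : Matrix ℕ ℕ ℝ := fun i j =>
  if i = j then α i else if j = i + 1 then β i else if i = j + 1 then β j else 0

/-- `p` is the sequence of monic orthogonal polynomials of `μ`. Positivity of all the norms
says that the monomials are linearly independent in `L²(μ)`, i.e. that the support of `μ` is
infinite; the sequence is then unique. -/
structure IsMonicOrthogonalSeq (μ : Measure ℝ) (p : ℕ → Polynomial ℝ) : Prop where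
  monic : ∀ n, (p n).Monic
  natDegree_eq : ∀ n, (p n).natDegree = n
  norm_pos : ∀ n, 0 < ∫ x, (p n).eval x ^ 2 ∂μ
  orthogonal : ∀ m n, m ≠ n → ∫ x, (p m).eval x * (p n).eval x ∂μ = 0

/-- `J` is the Jacobi matrix of `μ`: all moments of `μ` are finite, and `J` is formed from the
coefficients of the three term recurrence of the monic orthogonal polynomials of `μ`. -/
def IsJacobiMatrixOf (J : Matrix ℕ ℕ ℝ) (μ : Measure ℝ) : Prop :=
  (∀ n : ℕ, Integrable (fun x : ℝ => x ^ n) μ) ∧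
  ∃ (α β : ℕ → ℝ) (p : ℕ → Polynomial ℝ),
    (∀ n, 0 < β n) ∧ J = jacobiMatrix α β ∧ IsMonicOrthogonalSeq μ p ∧
    p 0 = 1 ∧ p 1 = Polynomial.X - Polynomial.C (α 0) ∧
    ∀ n, p (n + 2) = Polynomial.X * p (n + 1) - Polynomial.C (α (n + 1)) * p (n + 1)
      - Polynomial.C (β n ^ 2) * p n

/-! ### The explicit parameters -/

/-- `λ̂_0`. -/
def lambdaHat0 (a b c : ℝ) : ℝ := (c + a + 1) / (2 * c + a + b + 2)

/-- `μ_n`. -/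
def mu (a b c : ℝ) (n : ℕ) : ℝ :=
  (n + c) / (2 * n + 2 * c + a + b + 1) * ((n + c + b) / (2 * n + 2 * c + a + b))

/-- `λ_n^*`. -/
def lambdaStar (a b c : ℝ) (n : ℕ) : ℝ :=
  (n + c + a + 1) / (2 * n + 2 * c + a + b + 2) *
    ((n + c + a + b + 2) / (2 * n + 2 * c + a + b + 3))

/-- `μ_n^*`. -/
def muStar (a b c : ℝ) (n : ℕ) : ℝ :=
  (n + c + 1) / (2 * n + 2 * c + a + b + 3) *
    ((n + c + b + 2) / (2 * n + 2 * c + a + b + 4))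

/-- The matrix `J_c^*`. -/
def JStar (a b c : ℝ) : Matrix ℕ ℕ ℝ :=
  jacobiMatrix (fun n => lambdaStar a b c n + muStar a b c n)
    (fun n => √(muStar a b c n * lambdaStar a b c (n + 1)))

/-! ### The dual measure -/

/-- `Z^* = ⟨ν, x(1-x)⟩`. -/
def ZStar (ν : Measure ℝ) : ℝ := ∫ x, x * (1 - x) ∂ν

/-- `ν^* = (Z^*)⁻¹ x(1-x) ν(dx)`. -/
def nuStar (ν : Measure ℝ) : Measure ℝ :=
  (ENNReal.ofReal (ZStar ν))⁻¹ • ν.withDensity fun x => ENNReal.ofReal (x * (1 - x))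

end

end BetaJacobi

namespace BetaJacobi

open MeasureTheory Filter Topology

/-! The argument has a probabilistic half, which identifies the moments of the limit, and an
algebraic half, which turns these moments into a continued fraction.

Probabilistic half. The field `x^(k+1) * (1 - x)` vanishes at both endpoints, so moving every point
along it preserves the cube; differentiating the resulting change of variables gives the loop
equation `E[N * L * g + ∂g] = 0`, where `L` is `loopMean` and `∂g` is the derivative of `g` along
the field. Up to terms of order `β`, `L` is a quadratic expression in the power means with limiting
coefficients. The choice `g = L` yields `N * E[L^2] = -E[∂L]`, which is bounded in `N`, so `L` tends
to `0` in mean square (`meanConverges_loopMean`); concentration and the limit equation come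
together. The limit equation is `MomentRecursion`, which determines each moment from the lower ones,
so by induction the power means converge to `limitMoment` (`meanConverges_powerMean`). Compactness
of the probability measures on `[0,1]` provides a measure with these moments
(`exists_measure_limitMoment`), and Weierstrass approximation with Markov's inequality upgrades
convergence of moments to the required weak convergence (`isLimitingMeasure_of_moments`).

Algebraic half. If `M_c` is the generating function of the moments, `G_c = (1 - w) * M_c` solves a
Riccati equation whose power series solution with constant term `1` is unique (`riccati_unique`).
The moments of the dual measure are, up to the factor `Z`, the differences of consecutive moments,
so `G_c = 1 + g * w - Z * w^2 * S_c` with `S_c` the dual series. A Möbius transform of `G_(c+1)`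
solves the equation for `c`; by uniqueness it is `G_c`, which says `S_c = 1 / (1 - α * w - γ * w^2 *
S_(c+1))` (`dualSeries_continued_fraction`). The starred parameters depend on `n` and `c` only
through `n + c`, so iterating this step runs through the rows of `J_c^*`. A continued fraction with
positive coefficients yields the orthogonal polynomials directly (`mk_integral_recPoly`). -/

/-! ### The moment recursion and its Riccati equation -/

/-- The quadratic recursion satisfied by the moments of the limiting measure. -/
def MomentRecursion (a b c : ℝ) (m : ℕ → ℝ) : Prop :=
  m 0 = 1 ∧ ∀ k : ℕ, (k + 1 + a) * m k - (k + 2 + a + b) * m (k + 1)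
    + c * (∑ i ∈ Finset.range (k + 1), m i * m (k - i)
      - ∑ i ∈ Finset.range (k + 2), m i * m (k + 1 - i)) = 0

/-- The solution of the moment recursion. -/
noncomputable def limitMoment (a b c : ℝ) : ℕ → ℝ
  | 0 => 1
  | k + 1 => ((k + 1 + a) * limitMoment a b c k
      + c * (∑ i : Fin (k + 1), limitMoment a b c i * limitMoment a b c (k - i)
        - ∑ i : Fin k, limitMoment a b c (i + 1) * limitMoment a b c (k - i))) /
        (k + 2 + a + b + 2 * c)

theorem limitMoment_spec {a b c : ℝ} (ha : -1 < a) (hb : -1 < b) (hc : 0 < c) :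
    MomentRecursion a b c (limitMoment a b c) := by
  refine ⟨by rw [limitMoment], fun k => ?_⟩
  have hk : (0 : ℝ) ≤ k := Nat.cast_nonneg k
  have hne : (k + 2 + a + b + 2 * c : ℝ) ≠ 0 := by linarith
  have h0 : limitMoment a b c 0 = 1 := by rw [limitMoment]
  have h := limitMoment.eq_2 a b c k
  rw [eq_div_iff hne] at h
  -- The two end terms of the convolution both equal the unknown top moment; this is the origin of
  -- `2 * c` in the denominator of `limitMoment`.
  have hs : ∑ i ∈ Finset.range (k + 2), limitMoment a b c i * limitMoment a b c (k + 1 - i)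
      = ∑ i : Fin k, limitMoment a b c (i + 1) * limitMoment a b c (k - i)
        + 2 * limitMoment a b c (k + 1) := by
    rw [Finset.sum_range_succ, Finset.sum_range_succ', Nat.sub_self, h0, Finset.sum_range]
    simp only [Nat.add_sub_add_right, Nat.sub_zero]
    ring
  rw [hs, Finset.sum_range]
  linear_combination -h

open PowerSeries in
/-- The left-hand side of the Riccati equation of the function `(1 - w) ∑ mₖ wᵏ`. -/
noncomputable def riccati (a b c : ℝ) (G : PowerSeries ℝ) : PowerSeries ℝ :=
  -((1 - X) * X * derivative ℝ G) + (C a * X - C (a + b + 1)) * G - C c * G ^ 2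
    + C (1 + a + b + c) * (1 - X)

-- The recursion is a first order equation for the generating function with quadratic term `c * (X -
-- 1) * M^2`. Multiplying it by `1 - X` makes this `-c * G^2`, a quadratic term with constant
-- coefficient.
open PowerSeries in
theorem MomentRecursion.riccati_eq_zero {a b c : ℝ} {m : ℕ → ℝ} (hm : MomentRecursion a b c m) :
    riccati a b c ((1 - X) * mk m) = 0 := by
  have key : X * (mk m + X * derivative ℝ (mk m)) + C a * (X * mk m)
      - (mk m + X * derivative ℝ (mk m)) - C (a + b) * (mk m)
      + C c * (X * (mk m * mk m)) - C c * (mk m * mk m) + C (1 + a + b + c) = 0 := by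
    ext n
    rcases n with _ | k
    · simp [hm.1]
      ring
    · have h := hm.2 k
      rw [← Finset.Nat.sum_antidiagonal_eq_sum_range_succ (fun i j => m i * m j) k,
        ← Finset.Nat.sum_antidiagonal_eq_sum_range_succ (fun i j => m i * m j) (k + 1)] at h
      have hX : (k : ℝ) * m k = coeff k (X * derivative ℝ (mk m)) := by
        rcases k with _ | k
        · simp
        · rw [coeff_succ_X_mul, coeff_derivative, coeff_mk]
          push_cast
          ring
      simp only [map_add (coeff (k + 1)), map_sub (coeff (k + 1)), coeff_succ_X_mul, coeff_C_mul,
        map_add (coeff k), ← hX, coeff_derivative, coeff_mk, coeff_mul _ (mk m), coeff_succ_C,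
        map_zero]
      linear_combination h
  have hd : derivative ℝ ((1 - X) * mk m) = (1 - X) * derivative ℝ (mk m) - mk m := by
    simp [Derivation.leibniz]
    ring
  unfold riccati
  rw [hd]
  simp only [map_add, map_one] at key ⊢
  linear_combination (1 - X) * key

-- The difference of two solutions satisfies a linear equation whose coefficient of order `n + 1`
-- has the factor `n + 1 + (a + b + 1) + 2 * c > 0`. The constant terms must be prescribed, since
-- the equation at `X = 0` is quadratic and has a second root.
open PowerSeries in
theorem riccati_unique {a b c : ℝ} (ha : -1 < a) (hb : -1 < b) (hc : 0 < c) {G H : PowerSeries ℝ}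
    (hG : riccati a b c G = 0) (hH : riccati a b c H = 0) (hG0 : coeff 0 G = 1)
    (hH0 : coeff 0 H = 1) : G = H := by
  suffices h : ∀ n, coeff n (G - H) = 0 by
    ext n
    have := h n
    rw [map_sub] at this
    linarith
  set Δ := G - H with hΔ
  have heq : -(X * derivative ℝ Δ) + X * (X * derivative ℝ Δ) + C a * (X * Δ)
      - C (a + b + 1) * Δ - C c * ((G + H) * Δ) = 0 := by
    unfold riccati at hG hH
    rw [hΔ, map_sub]
    linear_combination hG - hH
  intro n
  induction n using Nat.strong_induction_on with
  | _ n ih =>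
    rcases n with _ | n
    · rw [hΔ, map_sub, hG0, hH0, sub_self]
    · have h1 := congrArg (coeff (n + 1)) heq
      have h2 : coeff (n + 1) ((G + H) * Δ) = 2 * coeff (n + 1) Δ := by
        rw [coeff_mul, Finset.Nat.antidiagonal_succ, Finset.sum_cons, Finset.sum_eq_zero]
        · rw [map_add, hG0, hH0]
          ring
        · rintro ⟨i, j⟩ hij
          obtain ⟨⟨p, q⟩, hpq, h⟩ := Finset.mem_map.1 hij
          have hpq' : p + q = n := Finset.HasAntidiagonal.mem_antidiagonal.1 hpq
          obtain ⟨rfl, rfl⟩ := Prod.mk.inj h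
          have hq : coeff q Δ = 0 := ih q (by omega)
          simp [hq]
      have h3 : coeff (n + 1) (X * (X * derivative ℝ Δ)) = 0 := by
        rw [coeff_succ_X_mul]
        rcases n with _ | n
        · simp
        · rw [coeff_succ_X_mul, coeff_derivative, ih (n + 1) (by omega), zero_mul]
      simp only [map_add (coeff (n + 1)), map_sub (coeff (n + 1)), map_neg, coeff_C_mul, h2, h3,
        coeff_succ_X_mul, coeff_derivative, ih n (by omega), map_zero] at h1
      have hn : (0 : ℝ) ≤ n := Nat.cast_nonneg n
      have : (n + 1 + (a + b + 1) + 2 * c) * coeff (n + 1) Δ = 0 := by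
        linear_combination -h1
      rcases mul_eq_zero.1 this with h | h
      · linarith
      · exact h

/-- A Möbius substitution carries one Riccati equation into another. -/
theorem riccati_moebius_identity {R : Type*} [CommRing R]
    {a b c g g' k α Z w H dH D E : R} (hD : D = 1 - α * w - k * (1 + g' * w - H)) (hE : D * E = 1)
    (h1 : (a + b + 2 + 2 * c) * g = -(1 + b + c))
    (h2 : k * (g + a * g - c * g ^ 2) = -(Z * (c + 1)))
    (h3 : (g + a * g - c * g ^ 2) * (1 - k) + Z * (2 + a + b + c) = 0)
    (h4 : (g + a * g - c * g ^ 2) * (α + k * g') = Z * (-1 - a + c * g))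
    (h5 : (3 + a + b + 2 * c) * (1 - k) - (2 + a + b + c) * (1 - k) = k * (2 + a + b + c))
    (h6 : -2 * (-1 - a + c * g) * (1 - k) - (3 + a + b + 2 * c) * (α + k * g')
      + (-2 - a + 2 * c * g) * (1 - k) + (α + k * g') = -(k * (2 + a + b + c)))
    (h7 : (-1 - a + c * g) * (α + k * g') - (-2 - a + 2 * c * g) * (α + k * g')
      - (α + k * g') - c * Z = 0)
    (hH : -((1 - w) * w * dH) + (a * w - (a + b + 1)) * H - (c + 1) * H ^ 2
      + (1 + a + b + (c + 1)) * (1 - w) = 0) :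
    -((1 - w) * w * (g - 2 * Z * w * E + Z * w ^ 2 * (E ^ 2 * (-α - k * (g' - dH)))))
      + (a * w - (a + b + 1)) * (1 + g * w - Z * w ^ 2 * E)
      - c * (1 + g * w - Z * w ^ 2 * E) ^ 2 + (1 + a + b + c) * (1 - w) = 0 := by
  set p := g + a * g - c * g ^ 2 with hp
  set v := α + k * g' with hv
  have hD' : D = (1 - k) - v * w + k * H := by rw [hD, hv]; ring
  -- The equation after clearing `D^2`; orders `0` and `1` in `w` have cancelled, the latter by
  -- `h1`. Eliminating `dH` through `hH` leaves a polynomial in `w` and `H`: `h2` is its `H^2` part,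
  -- `h3` and `h4` its `H` part, and `h5`, `h6`, `h7` finish the part free of `H`.
  have hmain : p * w ^ 2 * D ^ 2
      + Z * w ^ 2 * ((3 + a + b + 2 * c) + (-2 - a + 2 * c * g) * w) * D
      + ((1 - w) * w * (Z * w ^ 2) * (v - k * dH) - c * Z ^ 2 * w ^ 4) = 0 := by
    rw [hD']
    linear_combination (Z * k * w ^ 2) * hH + w ^ 2 * H ^ 2 * k * h2
      + 2 * w ^ 2 * H * k * h3 - 2 * w ^ 3 * H * k * h4
      + w ^ 2 * (1 - k) * h3 - 2 * w ^ 3 * (1 - k) * h4 + w ^ 4 * v * h4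
      + Z * w ^ 2 * h5 + Z * w ^ 3 * h6 + Z * w ^ 4 * h7
  have hT : D ^ 2 * (-((1 - w) * w * (g - 2 * Z * w * E
      + Z * w ^ 2 * (E ^ 2 * (-α - k * (g' - dH)))))
      + (a * w - (a + b + 1)) * (1 + g * w - Z * w ^ 2 * E)
      - c * (1 + g * w - Z * w ^ 2 * E) ^ 2 + (1 + a + b + c) * (1 - w)) = 0 := by
    linear_combination hmain - w * D ^ 2 * h1
      + (Z * w ^ 2 * ((3 + a + b + 2 * c) + (-2 - a + 2 * c * g) * w) * D
        + ((1 - w) * w * (Z * w ^ 2) * (v - k * dH) - c * Z ^ 2 * w ^ 4) * (D * E + 1)) * hE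
  have hE2 : E ^ 2 * D ^ 2 = 1 := by
    rw [← mul_pow, mul_comm, hE, one_pow]
  linear_combination E ^ 2 * hT - (-((1 - w) * w * (g - 2 * Z * w * E
      + Z * w ^ 2 * (E ^ 2 * (-α - k * (g' - dH)))))
      + (a * w - (a + b + 1)) * (1 + g * w - Z * w ^ 2 * E)
      - c * (1 + g * w - Z * w ^ 2 * E) ^ 2 + (1 + a + b + c) * (1 - w)) * hE2

/-! ### The dual moments and their continued fraction -/

theorem limitMoment_one {a b c : ℝ} (ha : -1 < a) (hb : -1 < b) (hc : 0 < c) :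
    limitMoment a b c 1 = lambdaHat0 a b c := by
  obtain ⟨h0, h⟩ := limitMoment_spec ha hb hc
  have hS : (2 * c + a + b + 2 : ℝ) ≠ 0 := by linarith
  have h1 := h 0
  simp [Finset.sum_range_succ, h0] at h1
  rw [lambdaHat0, eq_div_iff hS]
  linear_combination -h1

theorem limitMoment_two {a b c : ℝ} (ha : -1 < a) (hb : -1 < b) (hc : 0 < c) :
    (3 + a + b + 2 * c) * limitMoment a b c 2
      = (2 + a + 2 * c) * lambdaHat0 a b c - c * lambdaHat0 a b c ^ 2 := by
  obtain ⟨h0, h⟩ := limitMoment_spec ha hb hc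
  have h1 := h 1
  simp [Finset.sum_range_succ, h0, limitMoment_one ha hb hc] at h1
  linear_combination -h1

/-- `⟨ν, x (1 - x)⟩` in terms of the moments. -/
noncomputable def dualMass (a b c : ℝ) : ℝ := limitMoment a b c 1 - limitMoment a b c 2

/-- Parametrizing by `S = 2 * c + a + b + 2` instead of `b` reduces all denominators to `S` and `S +
1`, and makes positivity visible factor by factor. -/
theorem dualMass_eq {a b c S : ℝ} (ha : -1 < a) (hb : -1 < b) (hc : 0 < c)
    (hbS : b = S - 2 * c - a - 2) :
    dualMass a b c = (c + a + 1) * (S - c - a - 1) * (S - c) / (S ^ 2 * (S + 1)) := by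
  have hS : S ≠ 0 := by linarith
  have hS1 : S + 1 ≠ 0 := by linarith
  have e1 : 2 * c + a + b + 2 = S := by linarith
  have h2 := limitMoment_two ha hb hc
  have h2' : limitMoment a b c 2 = ((2 + a + 2 * c) * lambdaHat0 a b c
      - c * lambdaHat0 a b c ^ 2) / (S + 1) := by
    rw [eq_div_iff hS1, ← e1]
    linear_combination h2
  rw [dualMass, h2', limitMoment_one ha hb hc, lambdaHat0, e1]
  field_simp
  ring

theorem dualMass_eq_lambdaHat0 {a b c : ℝ} (ha : -1 < a) (hb : -1 < b) (hc : 0 < c) :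
    dualMass a b c = lambdaHat0 a b c * (1 - lambdaHat0 a b c - mu a b c 1) := by
  obtain ⟨S, hbS⟩ : ∃ S, b = S - 2 * c - a - 2 := ⟨b + 2 * c + a + 2, by ring⟩
  have hS : S ≠ 0 := by linarith
  have hS1 : S + 1 ≠ 0 := by linarith
  have e0 : 2 * c + a + b + 2 = S := by linarith
  have e1 : (2 * ((1 : ℕ) : ℝ) + 2 * c + a + b + 1) = S + 1 := by
    push_cast
    linarith
  have e2 : (2 * ((1 : ℕ) : ℝ) + 2 * c + a + b) = S := by
    push_cast
    linarith
  rw [dualMass_eq ha hb hc hbS, mu, lambdaHat0, e0, e1, e2, hbS]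
  push_cast
  field_simp
  ring

theorem dualMass_pos {a b c : ℝ} (ha : -1 < a) (hb : -1 < b) (hc : 0 < c) :
    0 < dualMass a b c := by
  obtain ⟨S, hbS⟩ : ∃ S, b = S - 2 * c - a - 2 := ⟨b + 2 * c + a + 2, by ring⟩
  rw [dualMass_eq ha hb hc hbS]
  have h1 : 0 < c + a + 1 := by linarith
  have h2 : 0 < S - c - a - 1 := by linarith
  have h3 : 0 < S - c := by linarith
  have h4 : 0 < S := by linarith
  positivity

open PowerSeries in
/-- The generating function of the moments of the dual measure. -/
noncomputable def dualSeries (a b c : ℝ) : PowerSeries ℝ :=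
  mk fun k => (limitMoment a b c (k + 1) - limitMoment a b c (k + 2)) / dualMass a b c

open PowerSeries in
theorem dualSeries_spec {a b c : ℝ} (ha : -1 < a) (hb : -1 < b) (hc : 0 < c) :
    (1 - X) * mk (limitMoment a b c)
      = 1 + C (limitMoment a b c 1 - 1) * X - C (dualMass a b c) * X ^ 2 * dualSeries a b c := by
  have h0 := (limitMoment_spec ha hb hc).1
  have hZ := (dualMass_pos ha hb hc).ne'
  have e : (1 + C (limitMoment a b c 1 - 1) * X
      - C (dualMass a b c) * X ^ 2 * dualSeries a b c : PowerSeries ℝ)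
      = 1 + C (limitMoment a b c 1 - 1) * X
      - C (dualMass a b c) * (X * (X * dualSeries a b c)) := by ring
  rw [e, sub_mul, one_mul]
  ext n
  rcases n with _ | _ | n
  · simp [h0]
  · simp [coeff_succ_X_mul, coeff_one, h0, coeff_zero_X_mul]
  · simp only [map_add (coeff (n + 2)), map_sub (coeff (n + 2)), coeff_succ_X_mul, coeff_C_mul,
      coeff_mk, dualSeries, coeff_one, coeff_X]
    have hn : n + 1 + 1 ≠ 1 := by omega
    have hn' : n + 1 + 1 ≠ 0 := by omega
    rw [if_neg hn, if_neg hn']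
    field_simp
    ring

theorem lambdaStar_pos {a b c : ℝ} (ha : -1 < a) (hb : -1 < b) (hc : 0 < c) (n : ℕ) :
    0 < lambdaStar a b c n := by
  have hn : (0 : ℝ) ≤ n := Nat.cast_nonneg n
  unfold lambdaStar
  apply mul_pos <;> apply div_pos <;> linarith

theorem muStar_pos {a b c : ℝ} (ha : -1 < a) (hb : -1 < b) (hc : 0 < c) (n : ℕ) :
    0 < muStar a b c n := by
  have hn : (0 : ℝ) ≤ n := Nat.cast_nonneg n
  unfold muStar
  apply mul_pos <;> apply div_pos <;> linarith

/-- Only `n + c` enters, so raising `c` by one deletes the first row and column of the matrix; this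
lets a single continued fraction step be iterated. -/
theorem lambdaStar_add (a b c : ℝ) (n k : ℕ) :
    lambdaStar a b (c + k) n = lambdaStar a b c (n + k) := by
  unfold lambdaStar
  push_cast
  ring_nf

theorem muStar_add (a b c : ℝ) (n k : ℕ) : muStar a b (c + k) n = muStar a b c (n + k) := by
  unfold muStar
  push_cast
  ring_nf

open PowerSeries in
/-- The first step of the continued fraction expansion of the dual generating function. -/
theorem dualSeries_continued_fraction {a b c : ℝ} (ha : -1 < a) (hb : -1 < b) (hc : 0 < c) :
    (1 - C (lambdaStar a b c 0 + muStar a b c 0) * X) * dualSeries a b c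
      = 1 + C (muStar a b c 0 * lambdaStar a b c 1) * X ^ 2
        * (dualSeries a b c * dualSeries a b (c + 1)) := by
  have hc1 : 0 < c + 1 := by linarith
  obtain ⟨S, hbS⟩ : ∃ S, b = S - 2 * c - a - 2 := ⟨b + 2 * c + a + 2, by ring⟩
  have hS : S ≠ 0 := by linarith
  have hS1 : S + 1 ≠ 0 := by linarith
  have hS2 : S + 2 ≠ 0 := by linarith
  have hS3 : S + 3 ≠ 0 := by linarith
  have e0 : 2 * c + a + b + 2 = S := by linarith
  have hbS' : b = (S + 2) - 2 * (c + 1) - a - 2 := by linarith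
  set g : ℝ := limitMoment a b c 1 - 1 with hg
  set g' : ℝ := limitMoment a b (c + 1) 1 - 1 with hg'
  -- Forced by the identities needed below: adding `h2` to `h3` gives `g + a * g - c * g^2 = -(S +
  -- 1) * Z`, and then `h2` determines `k`.
  set k : ℝ := (c + 1) / (S + 1) with hk
  set α : ℝ := lambdaStar a b c 0 + muStar a b c 0 with hα
  set Z : ℝ := dualMass a b c with hZ
  have hZpos : 0 < Z := dualMass_pos ha hb hc
  have eg : g = (c + a + 1 - S) / S := by
    rw [hg, limitMoment_one ha hb hc, lambdaHat0, e0]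
    field_simp
  have eg' : g' = (c + a - S) / (S + 2) := by
    have e : 2 * (c + 1) + a + b + 2 = S + 2 := by linarith
    rw [hg', limitMoment_one ha hb hc1, lambdaHat0, e]
    field_simp
    ring
  have eZ : Z = (c + a + 1) * (S - c - a - 1) * (S - c) / (S ^ 2 * (S + 1)) :=
    dualMass_eq ha hb hc hbS
  have eα : α = (c + a + 1) / S * ((S - c) / (S + 1))
      + (c + 1) / (S + 1) * ((S - c - a) / (S + 2)) := by
    rw [hα, lambdaStar, muStar, hbS]
    push_cast
    ring_nf
  set H : PowerSeries ℝ := (1 - X) * mk (limitMoment a b (c + 1)) with hH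
  have hHs := dualSeries_spec ha hb hc1
  have hHr := (limitMoment_spec ha hb hc1).riccati_eq_zero
  rw [← hH] at hHs hHr
  -- The expected reciprocal of the dual series. By `hHs` the bracket is the dual mass at `c + 1`
  -- times `X^2` times the dual series at `c + 1`, so `D` is affine in the Riccati solution `H`.
  set D : PowerSeries ℝ := 1 - C α * X - C k * (1 + C g' * X - H) with hD
  have hH0 : constantCoeff H = 1 := by
    simp [hH, (limitMoment_spec ha hb hc1).1]
  have hD0 : constantCoeff D ≠ 0 := by
    simp [hD, hH0]
  have hDE : D * D⁻¹ = 1 := PowerSeries.mul_inv_cancel D hD0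
  have h1 : (a + b + 2 + 2 * c) * g = -(1 + b + c) := by
    rw [eg, hbS]
    field_simp
    ring
  have h2 : k * (g + a * g - c * g ^ 2) = -(Z * (c + 1)) := by
    rw [eg, eZ, hk]
    field_simp
    ring
  have h3 : (g + a * g - c * g ^ 2) * (1 - k) + Z * (2 + a + b + c) = 0 := by
    rw [eg, eZ, hk, hbS]
    field_simp
    ring
  have h4 : (g + a * g - c * g ^ 2) * (α + k * g') = Z * (-1 - a + c * g) := by
    rw [eg, eg', eZ, hk, eα]
    field_simp
    ring
  have h5 : (3 + a + b + 2 * c) * (1 - k) - (2 + a + b + c) * (1 - k)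
      = k * (2 + a + b + c) := by
    rw [hk, hbS]
    field_simp
    ring
  have h6 : -2 * (-1 - a + c * g) * (1 - k) - (3 + a + b + 2 * c) * (α + k * g')
      + (-2 - a + 2 * c * g) * (1 - k) + (α + k * g') = -(k * (2 + a + b + c)) := by
    rw [eg, eg', hk, eα, hbS]
    field_simp
    ring
  have h7 : (-1 - a + c * g) * (α + k * g') - (-2 - a + 2 * c * g) * (α + k * g')
      - (α + k * g') - c * Z = 0 := by
    rw [eg, eg', hk, eα, eZ]
    field_simp
    ring
  have hdD : derivative ℝ D = -C α - C k * (C g' - derivative ℝ H) := by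
    simp [hD, Derivation.leibniz]
  have hC2 : C (2 : ℝ) = 2 := map_ofNat C 2
  have hC3 : C (3 : ℝ) = 3 := map_ofNat C 3
  have hric : riccati a b c (1 + C g * X - C Z * X ^ 2 * D⁻¹) = 0 := by
    have hd : derivative ℝ (1 + C g * X - C Z * X ^ 2 * D⁻¹) = C g - 2 * C Z * X * D⁻¹
        + C Z * X ^ 2 * (D⁻¹ ^ 2 * (-C α - C k * (C g' - derivative ℝ H))) := by
      rw [← hdD]
      simp [Derivation.leibniz]
      ring
    have h := riccati_moebius_identity (a := C a) (b := C b) (c := C c) (g := C g) (g' := C g')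
      (k := C k) (α := C α) (Z := C Z) (w := X) (H := H) (dH := derivative ℝ H) (D := D)
      (E := D⁻¹) hD hDE
      (by simpa [hC2, hC3] using congrArg (C (R := ℝ)) h1) (by simpa [hC2, hC3] using congrArg (C (R := ℝ)) h2)
      (by simpa [hC2, hC3] using congrArg (C (R := ℝ)) h3) (by simpa [hC2, hC3] using congrArg (C (R := ℝ)) h4)
      (by simpa [hC2, hC3] using congrArg (C (R := ℝ)) h5) (by simpa [hC2, hC3] using congrArg (C (R := ℝ)) h6)
      (by simpa [hC2, hC3] using congrArg (C (R := ℝ)) h7)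
      (by simpa [riccati] using hHr)
    unfold riccati
    rw [hd]
    simpa using h
  have hG := riccati_unique ha hb hc (limitMoment_spec ha hb hc).riccati_eq_zero hric
    (by simp [(limitMoment_spec ha hb hc).1]) (by simp)
  rw [dualSeries_spec ha hb hc, ← hg, ← hZ] at hG
  have hCZ : (C Z * X ^ 2 : PowerSeries ℝ) ≠ 0 :=
    mul_ne_zero (by simpa using hZpos.ne') (pow_ne_zero _ X_ne_zero)
  have hs : dualSeries a b c = D⁻¹ := by
    apply mul_left_cancel₀ hCZ
    linear_combination -hG
  have hkZ : muStar a b c 0 * lambdaStar a b c 1 = k * dualMass a b (c + 1) := by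
    have e2 : 2 * c + a + b + 3 = S + 1 := by linarith
    have e3 : 2 * c + a + b + 4 = S + 2 := by linarith
    have e4 : 2 + 2 * c + a + b + 2 = S + 2 := by linarith
    have e5 : 2 + 2 * c + a + b + 3 = S + 3 := by linarith
    have e6 : S + 2 + 1 = S + 3 := by ring
    rw [dualMass_eq ha hb hc1 hbS', hk, lambdaStar, muStar]
    simp only [Nat.cast_zero, Nat.cast_one, mul_zero, zero_add, mul_one]
    rw [e2, e3, e4, e5, e6, hbS]
    field_simp
    ring
  rw [hkZ, map_mul, hs]
  rw [hD, hHs] at hDE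
  rw [hD, hHs]
  linear_combination hDE

/-! ### Orthogonal polynomials of the dual measure -/

/-- The monic polynomials with recurrence coefficients `α n` and `γ n`. -/
noncomputable def recPoly (α γ : ℕ → ℝ) : ℕ → Polynomial ℝ
  | 0 => 1
  | 1 => Polynomial.X - Polynomial.C (α 0)
  | n + 2 => Polynomial.X * recPoly α γ (n + 1) - Polynomial.C (α (n + 1)) * recPoly α γ (n + 1)
      - Polynomial.C (γ n) * recPoly α γ n

theorem recPoly_monic_natDegree (α γ : ℕ → ℝ) (n : ℕ) :
    (recPoly α γ n).Monic ∧ (recPoly α γ n).natDegree = n := by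
  induction n using Nat.strong_induction_on with
  | _ n ih =>
    match n with
    | 0 => simp [recPoly]
    | 1 => exact ⟨by rw [recPoly]; exact Polynomial.monic_X_sub_C _,
        by rw [recPoly]; exact Polynomial.natDegree_X_sub_C _⟩
    | n + 2 =>
      obtain ⟨m1, d1⟩ := ih (n + 1) (by omega)
      obtain ⟨m0, d0⟩ := ih n (by omega)
      have e : recPoly α γ (n + 2) = (Polynomial.X - Polynomial.C (α (n + 1)))
          * recPoly α γ (n + 1) - Polynomial.C (γ n) * recPoly α γ n := by
        rw [recPoly]
        ring
      have hm : ((Polynomial.X - Polynomial.C (α (n + 1))) * recPoly α γ (n + 1)).Monic :=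
        (Polynomial.monic_X_sub_C _).mul m1
      have hd : ((Polynomial.X - Polynomial.C (α (n + 1))) * recPoly α γ (n + 1)).natDegree
          = n + 2 := by
        rw [(Polynomial.monic_X_sub_C _).natDegree_mul m1, Polynomial.natDegree_X_sub_C, d1]
        ring
      have hlt : (Polynomial.C (γ n) * recPoly α γ n).natDegree < n + 2 :=
        lt_of_le_of_lt (Polynomial.natDegree_C_mul_le _ _) (by omega)
      rw [e]
      refine ⟨hm.sub_of_left ?_, ?_⟩
      · rw [Polynomial.degree_eq_natDegree hm.ne_zero, hd]
        exact lt_of_le_of_lt Polynomial.degree_le_natDegree (by exact_mod_cast hlt)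
      · rw [Polynomial.natDegree_sub_eq_left_of_natDegree_lt (by rw [hd]; exact hlt), hd]

theorem integrable_polynomial {μ : Measure ℝ} (hint : ∀ n : ℕ, Integrable (fun x : ℝ => x ^ n) μ)
    (p : Polynomial ℝ) : Integrable (fun x => p.eval x) μ := by
  induction p using Polynomial.induction_on' with
  | add p q hp hq =>
    simp only [Polynomial.eval_add]
    exact hp.add hq
  | monomial n r => simpa using (hint n).const_mul r

theorem integrable_eval_mul_pow {μ : Measure ℝ}
    (hint : ∀ n : ℕ, Integrable (fun x : ℝ => x ^ n) μ) (p : Polynomial ℝ) (k : ℕ) :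
    Integrable (fun x => p.eval x * x ^ k) μ := by
  have := integrable_polynomial hint (p * Polynomial.X ^ k)
  simp only [Polynomial.eval_mul, Polynomial.eval_pow, Polynomial.eval_X] at this
  exact this

/-- A sequence of monic polynomials orthogonal to lower monomials is orthogonal. -/
theorem isMonicOrthogonalSeq_of_moments {μ : Measure ℝ}
    (hint : ∀ n : ℕ, Integrable (fun x : ℝ => x ^ n) μ) {p : ℕ → Polynomial ℝ}
    (hmonic : ∀ n, (p n).Monic) (hdeg : ∀ n, (p n).natDegree = n)
    (hlow : ∀ n k, k < n → ∫ x, (p n).eval x * x ^ k ∂μ = 0)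
    (hpos : ∀ n, 0 < ∫ x, (p n).eval x * x ^ n ∂μ) : IsMonicOrthogonalSeq μ p := by
  have hI := integrable_eval_mul_pow hint
  have hexp : ∀ n (q : Polynomial ℝ), ∫ x, (p n).eval x * q.eval x ∂μ
      = ∑ k ∈ Finset.range (q.natDegree + 1), q.coeff k * ∫ x, (p n).eval x * x ^ k ∂μ := by
    intro n q
    have e : ∀ x, (p n).eval x * q.eval x = ∑ k ∈ Finset.range (q.natDegree + 1),
        q.coeff k * ((p n).eval x * x ^ k) := by
      intro x
      rw [Polynomial.eval_eq_sum_range (p := q), Finset.mul_sum]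
      exact Finset.sum_congr rfl fun k _ => by ring
    simp_rw [e]
    rw [integral_finsetSum]
    · simp_rw [integral_const_mul]
    · intro k _
      exact (hI (p n) k).const_mul _
  have hlt : ∀ m n, m < n → ∫ x, (p n).eval x * (p m).eval x ∂μ = 0 := by
    intro m n hmn
    rw [hexp n (p m), hdeg]
    refine Finset.sum_eq_zero fun k hk => ?_
    rw [hlow n k (by have := Finset.mem_range.1 hk; omega), mul_zero]
  refine ⟨hmonic, hdeg, fun n => ?_, fun m n hmn => ?_⟩
  · simp_rw [pow_two]
    rw [hexp n (p n), hdeg, Finset.sum_range_succ, Finset.sum_eq_zero, zero_add]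
    · have := (hmonic n).coeff_natDegree
      rw [hdeg] at this
      rw [this, one_mul]
      exact hpos n
    · intro k hk
      rw [hlow n k (Finset.mem_range.1 hk), mul_zero]
  · rcases lt_or_gt_of_ne hmn with h | h
    · simp_rw [mul_comm ((p m).eval _)]
      exact hlt m n h
    · exact hlt n m h

open PowerSeries in
/-- The series `∑ ⟨μ, pₙ xᵏ⟩ wᵏ` factorizes when the moment series has an iterated continued
fraction expansion with coefficients `α`, `γ`. -/
theorem mk_integral_recPoly {μ : Measure ℝ}
    (hint : ∀ n : ℕ, Integrable (fun x : ℝ => x ^ n) μ) {α γ : ℕ → ℝ} {s : ℕ → PowerSeries ℝ}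
    (h0 : mk (fun k => ∫ x, x ^ k ∂μ) = s 0)
    (hs : ∀ n, (1 - C (α n) * X) * s n = 1 + C (γ n) * X ^ 2 * (s n * s (n + 1))) (n : ℕ) :
    mk (fun k => ∫ x, (recPoly α γ n).eval x * x ^ k ∂μ)
      = C (∏ j ∈ Finset.range n, γ j) * X ^ n * ∏ j ∈ Finset.range (n + 1), s j := by
  have hI := integrable_eval_mul_pow hint
  -- Multiplying the polynomial by `x` divides the series by `X` once its constant term is removed.
  -- That term is `1` for `p = 1` and vanishes for later polynomials because their series starts
  -- with `X^(n + 1)`.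
  have hshift : ∀ p : Polynomial ℝ, X * mk (fun k => ∫ x, p.eval x * x ^ (k + 1) ∂μ)
      = mk (fun k => ∫ x, p.eval x * x ^ k ∂μ) - C (∫ x, p.eval x ∂μ) := by
    intro p
    ext k
    rcases k with _ | k
    · simp
    · simp [coeff_succ_X_mul]
  induction n using Nat.strong_induction_on with
  | _ n ih =>
    match n with
    | 0 => simpa [recPoly] using h0
    | 1 =>
      have e : mk (fun k => ∫ x, (recPoly α γ 1).eval x * x ^ k ∂μ)
          = mk (fun k => ∫ x, (1 : Polynomial ℝ).eval x * x ^ (k + 1) ∂μ)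
            - C (α 0) * mk (fun k => ∫ x, x ^ k ∂μ) := by
        ext k
        simp only [coeff_mk, map_sub, coeff_C_mul, recPoly, Polynomial.eval_sub,
          Polynomial.eval_X, Polynomial.eval_C, Polynomial.eval_one, one_mul]
        rw [← integral_const_mul, ← integral_sub (hint _) ((hint _).const_mul _)]
        refine integral_congr_ae (ae_of_all _ fun x => ?_)
        simp only
        ring
      have h00 : C (∫ x, (1 : Polynomial ℝ).eval x ∂μ) = (1 : PowerSeries ℝ) := by
        have h1 := congrArg (coeff 0) (hs 0)
        have h2 := congrArg (coeff 0) h0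
        simp at h1 h2
        simp only [Polynomial.eval_one, integral_const, smul_eq_mul, mul_one]
        rw [h2, h1, map_one]
      have h := hshift 1
      rw [h00] at h
      simp only [Polynomial.eval_one, one_mul] at h e
      apply X_mul_cancel
      rw [e, mul_sub, h, h0, Finset.prod_range_one, Finset.prod_range_succ,
        Finset.prod_range_one]
      linear_combination hs 0
    | n + 2 =>
      have i1 := ih (n + 1) (by omega)
      have i0 := ih n (by omega)
      have e : mk (fun k => ∫ x, (recPoly α γ (n + 2)).eval x * x ^ k ∂μ)
          = mk (fun k => ∫ x, (recPoly α γ (n + 1)).eval x * x ^ (k + 1) ∂μ)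
            - C (α (n + 1)) * mk (fun k => ∫ x, (recPoly α γ (n + 1)).eval x * x ^ k ∂μ)
            - C (γ n) * mk (fun k => ∫ x, (recPoly α γ n).eval x * x ^ k ∂μ) := by
        ext k
        simp only [coeff_mk, map_sub, coeff_C_mul, recPoly, Polynomial.eval_sub,
          Polynomial.eval_X, Polynomial.eval_C, Polynomial.eval_mul]
        rw [← integral_const_mul, ← integral_const_mul,
          ← integral_sub (hI _ _) ((hI _ _).const_mul _),
          ← integral_sub (by exact (hI _ _).sub ((hI _ _).const_mul _)) ((hI _ _).const_mul _)]
        refine integral_congr_ae (ae_of_all _ fun x => ?_)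
        simp only
        ring
      have h00 : ∫ x, (recPoly α γ (n + 1)).eval x ∂μ = 0 := by
        have := congrArg (coeff 0) i1
        simpa using this
      have h := hshift (recPoly α γ (n + 1))
      rw [h00, map_zero, sub_zero] at h
      apply X_mul_cancel
      rw [e, mul_sub, mul_sub, h, i1, i0, Finset.prod_range_succ _ (n + 2),
        Finset.prod_range_succ _ (n + 1), Finset.prod_range_succ γ (n + 1),
        Finset.prod_range_succ γ n]
      simp only [map_mul]
      linear_combination (C (∏ j ∈ Finset.range n, γ j) * C (γ n) * X ^ (n + 1)
        * ∏ j ∈ Finset.range (n + 1), s j) * hs (n + 1)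

open PowerSeries in
/-- A measure whose moment series has a continued fraction expansion with positive coefficients
has the corresponding Jacobi matrix. -/
theorem isJacobiMatrixOf_of_continued_fraction {μ : Measure ℝ}
    (hint : ∀ n : ℕ, Integrable (fun x : ℝ => x ^ n) μ) {α γ : ℕ → ℝ} (hγ : ∀ n, 0 < γ n)
    {s : ℕ → PowerSeries ℝ} (h0 : mk (fun k => ∫ x, x ^ k ∂μ) = s 0)
    (hs : ∀ n, (1 - C (α n) * X) * s n = 1 + C (γ n) * X ^ 2 * (s n * s (n + 1))) :
    IsJacobiMatrixOf (jacobiMatrix α fun n => √(γ n)) μ := by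
  have hmk := mk_integral_recPoly hint h0 hs
  have hs1 : ∀ n, constantCoeff (s n) = 1 := by
    intro n
    have := congrArg constantCoeff (hs n)
    simpa using this
  refine ⟨hint, α, fun n => √(γ n), recPoly α γ, fun n => Real.sqrt_pos.2 (hγ n), rfl, ?_, rfl,
    rfl, fun n => ?_⟩
  · refine isMonicOrthogonalSeq_of_moments hint (fun n => (recPoly_monic_natDegree α γ n).1)
      (fun n => (recPoly_monic_natDegree α γ n).2) (fun n k hk => ?_) fun n => ?_
    -- The series starts with `X^n`, so the lower pairings vanish; its leading coefficient is a
    -- product of the positive `γ j`, because every `s j` has constant term `1`.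
    · have := congrArg (coeff k) (hmk n)
      rw [coeff_mk, mul_assoc, coeff_C_mul, coeff_X_pow_mul', if_neg (by omega), mul_zero] at this
      exact this
    · have := congrArg (coeff n) (hmk n)
      rw [coeff_mk, mul_assoc, coeff_C_mul, coeff_X_pow_mul', if_pos le_rfl, Nat.sub_self,
        coeff_zero_eq_constantCoeff_apply, map_prod, Finset.prod_congr rfl fun j _ => hs1 j,
        Finset.prod_const_one, mul_one] at this
      rw [this]
      exact Finset.prod_pos fun j _ => hγ j
  · rw [Real.sq_sqrt (hγ n).le, recPoly]

open PowerSeries in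
theorem isJacobiMatrixOf_JStar {a b c : ℝ} (ha : -1 < a) (hb : -1 < b) (hc : 0 < c)
    {μ : Measure ℝ} (hint : ∀ n : ℕ, Integrable (fun x : ℝ => x ^ n) μ)
    (h0 : mk (fun k => ∫ x, x ^ k ∂μ) = dualSeries a b c) :
    IsJacobiMatrixOf (JStar a b c) μ := by
  refine isJacobiMatrixOf_of_continued_fraction hint
    (fun n => mul_pos (muStar_pos ha hb hc n) (lambdaStar_pos ha hb hc (n + 1)))
    (s := fun n => dualSeries a b (c + n)) (by simpa using h0) fun n => ?_
  have hn : 0 < c + n := by positivity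
  have h := dualSeries_continued_fraction ha hb hn
  rw [lambdaStar_add, lambdaStar_add, muStar_add, zero_add, add_comm 1 n] at h
  have e : c + ((n + 1 : ℕ) : ℝ) = c + n + 1 := by
    push_cast
    ring
  rw [e]
  exact h

/-! ### Basic properties of the ensembles -/

/-- The cube `[0,1]^N`. -/
def cube (N : ℕ) : Set (Fin N → ℝ) := Set.univ.pi fun _ => Set.Icc 0 1

theorem mem_cube {N : ℕ} {x : Fin N → ℝ} : x ∈ cube N ↔ ∀ i, 0 ≤ x i ∧ x i ≤ 1 := by
  simp only [cube, Set.mem_univ_pi, Set.mem_Icc]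

theorem measurableSet_cube (N : ℕ) : MeasurableSet (cube N) :=
  MeasurableSet.univ_pi fun _ => measurableSet_Icc

theorem isCompact_cube (N : ℕ) : IsCompact (cube N) := isCompact_univ_pi fun _ => isCompact_Icc

theorem measurable_weight (N : ℕ) (β a b : ℝ) : Measurable (weight N β a b) := by
  unfold weight
  fun_prop

theorem weight_nonneg {N : ℕ} (β a b : ℝ) {x : Fin N → ℝ} (hx : x ∈ cube N) :
    0 ≤ weight N β a b x := by
  rw [mem_cube] at hx
  refine mul_nonneg (Finset.prod_nonneg fun i _ => Finset.prod_nonneg fun j _ => by positivity)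
    (Finset.prod_nonneg fun l _ => mul_nonneg ?_ ?_)
  · exact Real.rpow_nonneg (hx l).1 _
  · exact Real.rpow_nonneg (by linarith [(hx l).2]) _

theorem weight_pos {N : ℕ} (β a b : ℝ) {x : Fin N → ℝ} (hx : ∀ i, 0 < x i ∧ x i < 1)
    (hinj : Function.Injective x) : 0 < weight N β a b x := by
  refine mul_pos (Finset.prod_pos fun i _ => Finset.prod_pos fun j hj => ?_)
    (Finset.prod_pos fun l _ => mul_pos ?_ ?_)
  · refine Real.rpow_pos_of_pos (abs_pos.2 (sub_ne_zero.2 fun h => ?_)) _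
    exact (Finset.mem_Ioi.1 hj).ne' (hinj h)
  · exact Real.rpow_pos_of_pos (hx l).1 _
  · exact Real.rpow_pos_of_pos (by linarith [(hx l).2]) _

theorem integrableOn_beta {a b : ℝ} (ha : -1 < a) (hb : -1 < b) :
    IntegrableOn (fun x : ℝ => x ^ a * (1 - x) ^ b) (Set.Icc 0 1) := by
  have h := (Complex.betaIntegral_convergent (u := ((a + 1 : ℝ) : ℂ)) (v := ((b + 1 : ℝ) : ℂ))
    (by simpa using by linarith) (by simpa using by linarith)).norm
  rw [intervalIntegrable_iff_integrableOn_Ioo_of_le zero_le_one] at h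
  rw [integrableOn_Icc_iff_integrableOn_Ioo]
  refine h.congr_fun (fun x hx => ?_) measurableSet_Ioo
  have h1 : (1 - (x : ℂ)) = ((1 - x : ℝ) : ℂ) := by push_cast; rfl
  simp only [norm_mul]
  rw [h1, Complex.norm_cpow_eq_rpow_re_of_pos hx.1,
    Complex.norm_cpow_eq_rpow_re_of_pos (by linarith [hx.2])]
  simp

/-- On the cube the interaction factor is at most `1`, so a product of one-dimensional beta
densities dominates. -/
theorem integrableOn_weight (N : ℕ) {β a b : ℝ} (hβ : 0 < β) (ha : -1 < a) (hb : -1 < b) :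
    IntegrableOn (weight N β a b) (cube N) := by
  have h : IntegrableOn (fun x : Fin N → ℝ => ∏ l, (x l ^ a * (1 - x l) ^ b)) (cube N) := by
    unfold IntegrableOn cube
    rw [volume_pi, Measure.restrict_pi_pi]
    exact Integrable.fintype_prod (f := fun _ (y : ℝ) => y ^ a * (1 - y) ^ b)
      fun _ => integrableOn_beta ha hb
  refine Integrable.mono' h (measurable_weight N β a b).aestronglyMeasurable ?_
  filter_upwards [ae_restrict_mem (measurableSet_cube N)] with x hx
  rw [Real.norm_of_nonneg (weight_nonneg β a b hx), weight]
  rw [mem_cube] at hx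
  refine mul_le_of_le_one_left (Finset.prod_nonneg fun l _ => mul_nonneg
    (Real.rpow_nonneg (hx l).1 _) (Real.rpow_nonneg (by linarith [(hx l).2]) _)) ?_
  refine Finset.prod_le_one (fun i _ => Finset.prod_nonneg fun j _ => by positivity) fun i _ =>
    Finset.prod_le_one (fun j _ => by positivity) fun j _ => ?_
  refine Real.rpow_le_one (abs_nonneg _) ?_ hβ.le
  rw [abs_le]
  constructor <;> linarith [(hx i).1, (hx i).2, (hx j).1, (hx j).2]

/-- The normalising constant. -/
noncomputable def partitionFunction (N : ℕ) (β a b : ℝ) : ℝ := ∫ x in cube N, weight N β a b x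

theorem partitionFunction_pos (N : ℕ) {β a b : ℝ} (hβ : 0 < β) (ha : -1 < a) (hb : -1 < b) :
    0 < partitionFunction N β a b := by
  unfold partitionFunction
  rw [setIntegral_pos_iff_support_of_nonneg_ae _ (integrableOn_weight N hβ ha hb)]
  -- Equally spaced interior points witness that the open set `U` of distinct interior
  -- configurations, where the density is positive, is nonempty.
  · set y : Fin N → ℝ := fun i => ((i : ℝ) + 1) / (N + 1) with hy
    set U : Set (Fin N → ℝ) := {x | (∀ i, 0 < x i ∧ x i < 1) ∧ ∀ i j, i ≠ j → x i ≠ x j} with hU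
    have hUo : IsOpen U := by
      have e : U = (⋂ i, ({x | 0 < x i} ∩ {x | x i < 1})) ∩ ⋂ i, ⋂ j, {x | i ≠ j → x i ≠ x j} := by
        ext x
        simp [hU]
      rw [e]
      refine IsOpen.inter (isOpen_iInter_of_finite fun i => IsOpen.inter
        (isOpen_lt continuous_const (continuous_apply i))
        (isOpen_lt (continuous_apply i) continuous_const))
        (isOpen_iInter_of_finite fun i => isOpen_iInter_of_finite fun j => ?_)
      by_cases hij : i = j
      · simp [hij]
      · simpa [hij] using isOpen_ne_fun (continuous_apply i) (continuous_apply j)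
    have hyU : y ∈ U := by
      have hN : (0 : ℝ) < N + 1 := by positivity
      refine ⟨fun i => ⟨by simp only [hy]; positivity, ?_⟩, fun i j hij h => hij ?_⟩
      · have : (i : ℝ) < N := by exact_mod_cast i.2
        simp only [hy]
        rw [div_lt_one hN]
        linarith
      · simp only [hy] at h
        rw [div_left_inj' hN.ne'] at h
        have : ((i : ℕ) : ℝ) = (j : ℕ) := by linarith
        exact Fin.ext (by exact_mod_cast this)
    refine lt_of_lt_of_le (hUo.measure_pos volume ⟨y, hyU⟩) (measure_mono fun x hx => ?_)
    refine ⟨(weight_pos β a b hx.1 fun i j h => ?_).ne', mem_cube.2 fun i =>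
      ⟨(hx.1 i).1.le, (hx.1 i).2.le⟩⟩
    by_contra hij
    exact hx.2 i j hij h
  · filter_upwards [ae_restrict_mem (measurableSet_cube N)] with x hx
    exact weight_nonneg β a b hx

theorem weightMeasure_univ (N : ℕ) {β a b : ℝ} (hβ : 0 < β) (ha : -1 < a) (hb : -1 < b) :
    weightMeasure N β a b Set.univ = ENNReal.ofReal (partitionFunction N β a b) := by
  rw [weightMeasure, withDensity_apply _ MeasurableSet.univ, Measure.restrict_univ,
    partitionFunction, ofReal_integral_eq_lintegral_ofReal (integrableOn_weight N hβ ha hb)]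
  · rfl
  · filter_upwards [ae_restrict_mem (measurableSet_cube N)] with x hx
    exact weight_nonneg β a b hx

theorem isProbabilityMeasure_ensemble (N : ℕ) {β a b : ℝ} (hβ : 0 < β) (ha : -1 < a)
    (hb : -1 < b) : IsProbabilityMeasure (ensemble N β a b) := by
  constructor
  rw [ensemble, Measure.smul_apply, smul_eq_mul, weightMeasure_univ N hβ ha hb]
  refine ENNReal.inv_mul_cancel ?_ ENNReal.ofReal_ne_top
  simpa using partitionFunction_pos N hβ ha hb

theorem ae_ensemble_mem_cube (N : ℕ) (β a b : ℝ) : ∀ᵐ x ∂(ensemble N β a b), x ∈ cube N := by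
  refine (Measure.smul_absolutelyContinuous.trans (withDensity_absolutelyContinuous _ _)).ae_le ?_
  exact ae_restrict_mem (measurableSet_cube N)

theorem integral_ensemble (N : ℕ) {β a b : ℝ} (hβ : 0 < β) (ha : -1 < a) (hb : -1 < b)
    (g : (Fin N → ℝ) → ℝ) : ∫ x, g x ∂(ensemble N β a b)
      = (partitionFunction N β a b)⁻¹ * ∫ x in cube N, weight N β a b x * g x := by
  rw [ensemble, integral_smul_measure, weightMeasure_univ N hβ ha hb, ENNReal.toReal_inv,
    ENNReal.toReal_ofReal (partitionFunction_pos N hβ ha hb).le, smul_eq_mul, weightMeasure,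
    integral_withDensity_eq_integral_toReal_smul
      (measurable_weight N β a b).ennreal_ofReal (ae_of_all _ fun x => ENNReal.ofReal_lt_top)]
  congr 1
  refine integral_congr_ae ?_
  filter_upwards [ae_restrict_mem (measurableSet_cube N)] with x hx
  rw [ENNReal.toReal_ofReal (weight_nonneg β a b hx), smul_eq_mul]

/-! ### The loop equation -/

/-- A vector field `f` on the line that vanishes at `0` and `1`, with its derivative `f'` and its
quotients `u`, `v`, `q` by `x`, `1 - x` and `x - y`. -/
structure IsBoundaryField (f f' u v : ℝ → ℝ) (q : ℝ → ℝ → ℝ) : Prop where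
  hasDerivAt : ∀ x, HasDerivAt f (f' x) x
  left : ∀ x, f x = x * u x
  right : ∀ x, f x = (1 - x) * v x
  diff : ∀ x y, f x - f y = (x - y) * q x y
  contDiff : ContDiff ℝ 1 f
  contDiff_deriv : ContDiff ℝ 1 f'
  contDiff_left : ContDiff ℝ 1 u
  contDiff_right : ContDiff ℝ 1 v
  contDiff_diff : ContDiff ℝ 1 (fun p : ℝ × ℝ => q p.1 p.2)

/-- The Euler approximation at time `ε` of the flow of `f` on configurations. -/
def flow {N : ℕ} (f : ℝ → ℝ) (ε : ℝ) (x : Fin N → ℝ) : Fin N → ℝ := fun i => x i + ε * f (x i)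

/-- The factor by which `flow f ε` changes the weight. -/
noncomputable def flowRatio {N : ℕ} (β a b : ℝ) (f' u v : ℝ → ℝ) (q : ℝ → ℝ → ℝ) (ε : ℝ)
    (x : Fin N → ℝ) : ℝ :=
  (∏ i, ∏ j ∈ Finset.Ioi i, (1 + ε * q (x j) (x i)) ^ β)
    * (∏ l, ((1 + ε * u (x l)) ^ a * (1 - ε * v (x l)) ^ b)) * ∏ l, (1 + ε * f' (x l))

/-- All factors in `flowRatio` are positive. -/
def FlowAdmissible (f' u v : ℝ → ℝ) (q : ℝ → ℝ → ℝ) (ε : ℝ) : Prop :=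
  ∀ x ∈ Set.Icc (0 : ℝ) 1, (0 < 1 + ε * u x ∧ 0 < 1 - ε * v x ∧ 0 < 1 + ε * f' x) ∧
    ∀ y ∈ Set.Icc (0 : ℝ) 1, 0 < 1 + ε * q x y

section

variable {f f' u v : ℝ → ℝ} {q : ℝ → ℝ → ℝ}

theorem IsBoundaryField.exists_admissible (hf : IsBoundaryField f f' u v q) :
    ∃ δ > 0, ∀ ε ∈ Set.Icc (-δ) δ, FlowAdmissible f' u v q ε := by
  obtain ⟨K₁, h₁⟩ := (isCompact_Icc (a := (0 : ℝ)) (b := 1)).exists_bound_of_continuousOn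
    hf.contDiff_left.continuous.continuousOn
  obtain ⟨K₂, h₂⟩ := (isCompact_Icc (a := (0 : ℝ)) (b := 1)).exists_bound_of_continuousOn
    hf.contDiff_right.continuous.continuousOn
  obtain ⟨K₃, h₃⟩ := (isCompact_Icc (a := (0 : ℝ)) (b := 1)).exists_bound_of_continuousOn
    hf.contDiff_deriv.continuous.continuousOn
  obtain ⟨K₄, h₄⟩ := ((isCompact_Icc (a := (0 : ℝ)) (b := 1)).prod
    (isCompact_Icc (a := (0 : ℝ)) (b := 1))).exists_bound_of_continuousOn
    hf.contDiff_diff.continuous.continuousOn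
  set K := max (max (max K₁ K₂) (max K₃ K₄)) 0 with hK
  have hK0 : 0 ≤ K := le_max_right _ _
  have hK' : max (max K₁ K₂) (max K₃ K₄) ≤ K := le_max_left _ _
  have key : ∀ ε ∈ Set.Icc (-(1 / (K + 1))) (1 / (K + 1)), ∀ t : ℝ, ‖t‖ ≤ K → |ε * t| < 1 := by
    intro ε hε t ht
    rw [abs_mul]
    calc |ε| * |t| ≤ 1 / (K + 1) * K := mul_le_mul (abs_le.2 hε) ht (abs_nonneg _) (by positivity)
      _ < 1 := by
        rw [one_div, inv_mul_lt_iff₀ (by positivity)]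
        linarith
  refine ⟨1 / (K + 1), by positivity, fun ε hε x hx => ⟨⟨?_, ?_, ?_⟩, fun y hy => ?_⟩⟩
  · linarith [(abs_lt.1 (key ε hε (u x) ((h₁ x hx).trans
      (((le_max_left _ _).trans (le_max_left _ _)).trans hK')))).1]
  · linarith [(abs_lt.1 (key ε hε (v x) ((h₂ x hx).trans
      (((le_max_right _ _).trans (le_max_left _ _)).trans hK')))).2]
  · linarith [(abs_lt.1 (key ε hε (f' x) ((h₃ x hx).trans
      (((le_max_left _ _).trans (le_max_right _ _)).trans hK')))).1]
  · linarith [(abs_lt.1 (key ε hε (q x y) ((h₄ (x, y) ⟨hx, hy⟩).trans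
      (((le_max_right _ _).trans (le_max_right _ _)).trans hK')))).1]

/-- Divisibility of `f` by `x` and `1 - x`, and of its differences by `x - y`, makes the flow
multiply each base in the weight by a positive smooth factor. The singular weight itself is
therefore never differentiated. -/
theorem IsBoundaryField.weight_flow (hf : IsBoundaryField f f' u v q) {N : ℕ} (β a b : ℝ) {ε : ℝ}
    (hε : FlowAdmissible f' u v q ε) {x : Fin N → ℝ} (hx : x ∈ cube N) :
    (∏ l, (1 + ε * f' (x l))) * weight N β a b (flow f ε x)
      = weight N β a b x * flowRatio β a b f' u v q ε x := by
  rw [mem_cube] at hx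
  have h1 : ∀ i j, |flow f ε x j - flow f ε x i| ^ β
      = |x j - x i| ^ β * (1 + ε * q (x j) (x i)) ^ β := by
    intro i j
    have hp := (hε (x j) (hx j)).2 (x i) (hx i)
    have e : flow f ε x j - flow f ε x i = (x j - x i) * (1 + ε * q (x j) (x i)) := by
      simp only [flow]
      linear_combination ε * hf.diff (x j) (x i)
    rw [e, abs_mul, abs_of_pos hp, Real.mul_rpow (abs_nonneg _) hp.le]
  have h2 : ∀ l, flow f ε x l ^ a = x l ^ a * (1 + ε * u (x l)) ^ a := by
    intro l
    have hp := (hε (x l) (hx l)).1.1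
    have e : flow f ε x l = x l * (1 + ε * u (x l)) := by
      simp only [flow]
      linear_combination ε * hf.left (x l)
    rw [e, Real.mul_rpow (hx l).1 hp.le]
  have h3 : ∀ l, (1 - flow f ε x l) ^ b = (1 - x l) ^ b * (1 - ε * v (x l)) ^ b := by
    intro l
    have hp := (hε (x l) (hx l)).1.2.1
    have e : 1 - flow f ε x l = (1 - x l) * (1 - ε * v (x l)) := by
      simp only [flow]
      linear_combination -ε * hf.right (x l)
    rw [e, Real.mul_rpow (by linarith [(hx l).2]) hp.le]
  simp only [weight, flowRatio, h1, h2, h3, Finset.prod_mul_distrib]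
  ring

/-- The flow acts coordinatewise and fixes `0` and `1`; positivity of the factors keeps it inside
`[0,1]`, and the intermediate value theorem gives surjectivity. -/
theorem IsBoundaryField.image_flow (hf : IsBoundaryField f f' u v q) {N : ℕ} {ε : ℝ}
    (hε : FlowAdmissible f' u v q ε) : flow f ε '' cube N = cube N := by
  have h1 : (fun t => t + ε * f t) '' Set.Icc 0 1 = Set.Icc (0 : ℝ) 1 := by
    apply Set.Subset.antisymm
    · rintro _ ⟨t, ht, rfl⟩
      have e1 : t + ε * f t = t * (1 + ε * u t) := by linear_combination ε * hf.left t
      have e2 : 1 - (t + ε * f t) = (1 - t) * (1 - ε * v t) := by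
        linear_combination -ε * hf.right t
      have p1 := mul_nonneg ht.1 (hε t ht).1.1.le
      have p2 := mul_nonneg (sub_nonneg.2 ht.2) (hε t ht).1.2.1.le
      exact ⟨by simp only; linarith, by simp only; linarith⟩
    · have hcont : Continuous fun t => t + ε * f t :=
        continuous_id.add (hf.contDiff.continuous.const_mul ε)
      have := intermediate_value_Icc (zero_le_one (α := ℝ)) hcont.continuousOn
      have e0 : f 0 = 0 := by rw [hf.left, zero_mul]
      have e1 : f 1 = 0 := by rw [hf.right, sub_self, zero_mul]
      simpa [e0, e1] using this
  have h2 := Set.piMap_image_univ_pi (fun (_ : Fin N) t => t + ε * f t)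
    (fun _ => Set.Icc (0 : ℝ) 1)
  simp only [h1] at h2
  exact h2

theorem IsBoundaryField.integral_flow (hf : IsBoundaryField f f' u v q) {N : ℕ} {ε : ℝ}
    (hε : FlowAdmissible f' u v q ε) (F : (Fin N → ℝ) → ℝ) :
    ∫ x in cube N, F x = ∫ x in cube N, (∏ l, (1 + ε * f' (x l))) * F (flow f ε x) := by
  set L : (Fin N → ℝ) → (Fin N → ℝ) →L[ℝ] (Fin N → ℝ) := fun x =>
    ContinuousLinearMap.pi fun i => ((1 + ε * f' (x i)) • ContinuousLinearMap.id ℝ ℝ).comp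
      (ContinuousLinearMap.proj i) with hL
  have hdet : ∀ x, (L x).det = ∏ l, (1 + ε * f' (x l)) := by
    intro x
    rw [hL]
    simp only
    rw [ContinuousLinearMap.det_pi]
    refine Finset.prod_congr rfl fun i _ => ?_
    simp [ContinuousLinearMap.det]
  have hder : ∀ x ∈ cube N, HasFDerivWithinAt (flow f ε) (L x) (cube N) x := by
    intro x _
    apply HasFDerivAt.hasFDerivWithinAt
    rw [hasFDerivAt_pi']
    intro i
    have h1 : HasDerivAt (fun t => t + ε * f t) (1 + ε * f' (x i)) (x i) :=
      (hasDerivAt_id _).add ((hf.hasDerivAt (x i)).const_mul ε)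
    have h2 : HasFDerivAt (fun y : Fin N → ℝ => y i) (ContinuousLinearMap.proj (R := ℝ) i) x :=
      (ContinuousLinearMap.proj (R := ℝ) (φ := fun _ : Fin N => ℝ) i).hasFDerivAt
    have h3 := h1.comp_hasFDerivAt x h2
    refine h3.congr_fderiv ?_
    ext w
    simp [hL]
  have hinj : Set.InjOn (flow f ε) (cube N) := by
    intro x hx y hy h
    rw [mem_cube] at hx hy
    ext i
    have hi := congrFun h i
    simp only [flow] at hi
    have hp := (hε (x i) (hx i)).2 (y i) (hy i)
    have : (x i - y i) * (1 + ε * q (x i) (y i)) = 0 := by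
      linear_combination hi - ε * hf.diff (x i) (y i)
    rcases mul_eq_zero.1 this with h | h
    · linarith
    · exact absurd h hp.ne'
  have h := integral_image_eq_integral_abs_det_fderiv_smul volume (measurableSet_cube N) hder hinj F
  rw [hf.image_flow hε] at h
  rw [h]
  refine setIntegral_congr_fun (measurableSet_cube N) fun x hx => ?_
  simp only [hdet, smul_eq_mul]
  rw [mem_cube] at hx
  rw [abs_of_pos (Finset.prod_pos fun l _ => (hε (x l) (hx l)).1.2.2)]

theorem hasDerivAt_prod_of_eq_one {ι : Type*} {s : Finset ι} {h : ι → ℝ → ℝ} {h' : ι → ℝ} {t : ℝ}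
    (hd : ∀ i ∈ s, HasDerivAt (h i) (h' i) t) (h1 : ∀ i ∈ s, h i t = 1) :
    HasDerivAt (fun e => ∏ i ∈ s, h i e) (∑ i ∈ s, h' i) t := by
  classical
  refine (HasDerivAt.fun_finsetProd hd).congr_deriv (Finset.sum_congr rfl fun i hi => ?_)
  rw [Finset.prod_eq_one fun j hj => h1 j (Finset.mem_of_mem_erase hj), one_smul]

/-- The logarithmic derivative of the weight along `f`, including the divergence of `f`. -/
noncomputable def loopTerm {N : ℕ} (β a b : ℝ) (f' u v : ℝ → ℝ) (q : ℝ → ℝ → ℝ)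
    (x : Fin N → ℝ) : ℝ :=
  (∑ i, ∑ j ∈ Finset.Ioi i, β * q (x j) (x i)) + (∑ l, (a * u (x l) - b * v (x l)))
    + ∑ l, f' (x l)

theorem hasDerivAt_flowRatio {N : ℕ} (β a b : ℝ) (f' u v : ℝ → ℝ) (q : ℝ → ℝ → ℝ)
    (x : Fin N → ℝ) : HasDerivAt (fun ε => flowRatio β a b f' u v q ε x)
      (loopTerm β a b f' u v q x) 0 := by
  have hlin : ∀ t : ℝ, HasDerivAt (fun ε : ℝ => 1 + ε * t) t 0 := by
    intro t
    simpa using ((hasDerivAt_id (0 : ℝ)).mul_const t).const_add 1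
  have hpow : ∀ t p : ℝ, HasDerivAt (fun ε : ℝ => (1 + ε * t) ^ p) (p * t) 0 := by
    intro t p
    have := (hlin t).rpow_const (p := p) (Or.inl (by simp))
    refine this.congr_deriv ?_
    simp
    ring
  have hA : HasDerivAt (fun ε => ∏ i, ∏ j ∈ Finset.Ioi i, (1 + ε * q (x j) (x i)) ^ β)
      (∑ i, ∑ j ∈ Finset.Ioi i, β * q (x j) (x i)) 0 :=
    hasDerivAt_prod_of_eq_one (fun i _ => hasDerivAt_prod_of_eq_one (fun j _ => hpow _ _)
      (fun j _ => by simp)) fun i _ => by simp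
  have hB : HasDerivAt (fun ε => ∏ l, ((1 + ε * u (x l)) ^ a * (1 - ε * v (x l)) ^ b))
      (∑ l, (a * u (x l) - b * v (x l))) 0 := by
    refine hasDerivAt_prod_of_eq_one (fun l _ => ?_) fun l _ => by simp
    have h := (hpow (u (x l)) a).mul (hpow (-v (x l)) b)
    have e : ∀ ε : ℝ, 1 - ε * v (x l) = 1 + ε * -v (x l) := fun ε => by ring
    simp only [e]
    refine h.congr_deriv ?_
    simp
    ring
  have hC : HasDerivAt (fun ε => ∏ l, (1 + ε * f' (x l))) (∑ l, f' (x l)) 0 :=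
    hasDerivAt_prod_of_eq_one (fun l _ => hlin _) fun l _ => by simp
  refine ((hA.mul hB).mul hC).congr_deriv ?_
  simp [loopTerm]

theorem hasDerivAt_comp_flow {N : ℕ} (f : ℝ → ℝ) {g : (Fin N → ℝ) → ℝ} (x : Fin N → ℝ)
    (hg : DifferentiableAt ℝ g x) :
    HasDerivAt (fun ε => g (flow f ε x)) (fderiv ℝ g x fun i => f (x i)) 0 := by
  have h0 : flow f 0 x = x := by
    ext i
    simp [flow]
  have h1 : HasDerivAt (fun ε => flow f ε x) (fun i => f (x i)) 0 := by
    rw [hasDerivAt_pi]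
    intro i
    simpa [flow] using ((hasDerivAt_id (0 : ℝ)).mul_const (f (x i))).const_add (x i)
  have h2 : HasFDerivAt g (fderiv ℝ g x) (flow f 0 x) := by
    rw [h0]
    exact hg.hasFDerivAt
  exact h2.comp_hasDerivAt 0 h1

/-- The domain on which all factors in `flowRatio` are positive. -/
def flowDomain (N : ℕ) (f' u v : ℝ → ℝ) (q : ℝ → ℝ → ℝ) : Set (ℝ × (Fin N → ℝ)) :=
  {p | ∀ i, ((0 < 1 + p.1 * u (p.2 i) ∧ 0 < 1 - p.1 * v (p.2 i)) ∧ 0 < 1 + p.1 * f' (p.2 i)) ∧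
    ∀ j, 0 < 1 + p.1 * q (p.2 j) (p.2 i)}

theorem IsBoundaryField.contDiff_factors (hf : IsBoundaryField f f' u v q) {N : ℕ}
    (i j : Fin N) :
    ContDiff ℝ 1 (fun p : ℝ × (Fin N → ℝ) => 1 + p.1 * u (p.2 i)) ∧
    ContDiff ℝ 1 (fun p : ℝ × (Fin N → ℝ) => 1 - p.1 * v (p.2 i)) ∧
    ContDiff ℝ 1 (fun p : ℝ × (Fin N → ℝ) => 1 + p.1 * f' (p.2 i)) ∧
    ContDiff ℝ 1 (fun p : ℝ × (Fin N → ℝ) => 1 + p.1 * q (p.2 j) (p.2 i)) := by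
  have hp : ∀ i : Fin N, ContDiff ℝ 1 (fun p : ℝ × (Fin N → ℝ) => p.2 i) := fun i =>
    (contDiff_apply ℝ ℝ i).comp contDiff_snd
  refine ⟨?_, ?_, ?_, ?_⟩
  · exact contDiff_const.add (contDiff_fst.mul (hf.contDiff_left.comp (hp i)))
  · exact contDiff_const.sub (contDiff_fst.mul (hf.contDiff_right.comp (hp i)))
  · exact contDiff_const.add (contDiff_fst.mul (hf.contDiff_deriv.comp (hp i)))
  · exact contDiff_const.add (contDiff_fst.mul (hf.contDiff_diff.comp ((hp j).prodMk (hp i))))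

theorem IsBoundaryField.isOpen_flowDomain (hf : IsBoundaryField f f' u v q) (N : ℕ) :
    IsOpen (flowDomain N f' u v q) := by
  simp only [flowDomain, Set.ofPred_forall, Set.ofPred_and]
  refine isOpen_iInter_of_finite fun i => IsOpen.inter (IsOpen.inter (IsOpen.inter ?_ ?_) ?_)
    (isOpen_iInter_of_finite fun j => ?_)
  · exact isOpen_lt continuous_const (hf.contDiff_factors i i).1.continuous
  · exact isOpen_lt continuous_const (hf.contDiff_factors i i).2.1.continuous
  · exact isOpen_lt continuous_const (hf.contDiff_factors i i).2.2.1.continuous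
  · exact isOpen_lt continuous_const (hf.contDiff_factors i j).2.2.2.continuous

/-- On `flowDomain` real powers are taken only of positive bases, so joint smoothness holds even
when `a` or `b` is negative or `β < 1`. -/
theorem IsBoundaryField.contDiffOn_flow (hf : IsBoundaryField f f' u v q) {N : ℕ} (β a b : ℝ)
    {g : (Fin N → ℝ) → ℝ} (hg : ContDiff ℝ 1 g) :
    ContDiffOn ℝ 1 (fun p : ℝ × (Fin N → ℝ) => flowRatio β a b f' u v q p.1 p.2
      * g (flow f p.1 p.2)) (flowDomain N f' u v q) := by
  intro p hp
  apply ContDiffAt.contDiffWithinAt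
  have hflow : ContDiff ℝ 1 (fun p : ℝ × (Fin N → ℝ) => flow f p.1 p.2) := by
    rw [contDiff_pi]
    intro i
    have hpi : ContDiff ℝ 1 (fun p : ℝ × (Fin N → ℝ) => p.2 i) :=
      (contDiff_apply ℝ ℝ i).comp contDiff_snd
    exact hpi.add (contDiff_fst.mul (hf.contDiff.comp hpi))
  refine ContDiffAt.mul ?_ (hg.comp hflow).contDiffAt
  unfold flowRatio
  refine ContDiffAt.mul (ContDiffAt.mul ?_ ?_) ?_
  · exact contDiffAt_prod fun i _ => contDiffAt_prod fun j _ =>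
      (hf.contDiff_factors i j).2.2.2.contDiffAt.rpow_const_of_ne ((hp i).2 j).ne'
  · exact contDiffAt_prod fun i _ =>
      ((hf.contDiff_factors i i).1.contDiffAt.rpow_const_of_ne (hp i).1.1.1.ne').mul
      ((hf.contDiff_factors i i).2.1.contDiffAt.rpow_const_of_ne (hp i).1.1.2.ne')
  · exact contDiffAt_prod fun i _ => (hf.contDiff_factors i i).2.2.1.contDiffAt

/-- The loop equation, for the unnormalised weight. -/
theorem IsBoundaryField.setIntegral_loop (hf : IsBoundaryField f f' u v q) {N : ℕ} {β a b : ℝ}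
    (hβ : 0 < β) (ha : -1 < a) (hb : -1 < b) {g : (Fin N → ℝ) → ℝ} (hg : ContDiff ℝ 1 g) :
    ∫ x in cube N, weight N β a b x * (loopTerm β a b f' u v q x * g x
      + fderiv ℝ g x fun i => f (x i)) = 0 := by
  obtain ⟨δ, hδ, hadm⟩ := hf.exists_admissible
  set G : ℝ × (Fin N → ℝ) → ℝ := fun p => flowRatio β a b f' u v q p.1 p.2
    * g (flow f p.1 p.2) with hG
  set U := flowDomain N f' u v q with hU
  have hUo : IsOpen U := hf.isOpen_flowDomain N
  have hGd : ContDiffOn ℝ 1 G U := hf.contDiffOn_flow β a b hg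
  have hsub : Set.Icc (-δ) δ ×ˢ cube N ⊆ U := by
    rintro ⟨ε, x⟩ ⟨hε, hx⟩ i
    simp only [mem_cube] at hx
    have h := hadm ε hε (x i) (hx i)
    exact ⟨⟨⟨h.1.1, h.1.2.1⟩, h.1.2.2⟩, fun j => (hadm ε hε (x j) (hx j)).2 (x i) (hx i)⟩
  have hcd : ContinuousOn (fderiv ℝ G) U := hGd.continuousOn_fderiv_of_isOpen hUo le_rfl
  obtain ⟨K, hK⟩ := (isCompact_Icc.prod (isCompact_cube N)).exists_bound_of_continuousOn
    (hcd.mono hsub)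
  have hder : ∀ ε ∈ Set.Icc (-δ) δ, ∀ x ∈ cube N,
      HasDerivAt (fun e => G (e, x)) (fderiv ℝ G (ε, x) (1, 0)) ε := by
    intro ε hε x hx
    have h1 : HasFDerivAt G (fderiv ℝ G (ε, x)) (ε, x) :=
      ((hGd.differentiableOn one_ne_zero).differentiableAt
        (hUo.mem_nhds (hsub ⟨hε, hx⟩))).hasFDerivAt
    have h2 : HasDerivAt (fun e : ℝ => (e, x)) ((1 : ℝ), (0 : Fin N → ℝ)) ε :=
      (hasDerivAt_id ε).prodMk (hasDerivAt_const ε x)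
    exact h1.comp_hasDerivAt ε h2
  have h0 : (0 : ℝ) ∈ Set.Icc (-δ) δ := ⟨by linarith, hδ.le⟩
  -- By the change of variables this integral does not depend on `ε`; its derivative at `0`,
  -- computed under the integral sign, is the loop equation.
  have hconst : ∀ ε ∈ Set.Icc (-δ) δ, ∫ x in cube N, weight N β a b x * G (ε, x)
      = ∫ x in cube N, weight N β a b x * g x := by
    intro ε hε
    rw [hf.integral_flow (hadm ε hε) fun x => weight N β a b x * g x]
    refine setIntegral_congr_fun (measurableSet_cube N) fun x hx => ?_
    have := hf.weight_flow β a b (hadm ε hε) hx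
    simp only [hG]
    rw [← mul_assoc, ← mul_assoc, this]
  have hmem : Set.Icc (-δ) δ ∈ 𝓝 (0 : ℝ) := Icc_mem_nhds (by linarith) hδ
  have hwm := (measurable_weight N β a b).aestronglyMeasurable
    (μ := (volume : Measure (Fin N → ℝ)).restrict (cube N))
  have hGm : ∀ ε ∈ Set.Icc (-δ) δ, ContinuousOn (fun x => G (ε, x)) (cube N) := fun ε hε =>
    hGd.continuousOn.comp (by fun_prop) fun x hx => hsub ⟨hε, hx⟩
  have hI := hasDerivAt_integral_of_dominated_loc_of_deriv_le (𝕜 := ℝ)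
    (μ := (volume : Measure (Fin N → ℝ)).restrict (cube N))
    (bound := fun x => weight N β a b x * (K * ‖((1 : ℝ), (0 : Fin N → ℝ))‖))
    (F := fun ε x => weight N β a b x * G (ε, x))
    (F' := fun ε x => weight N β a b x * fderiv ℝ G (ε, x) (1, 0)) hmem
    (by
      filter_upwards [hmem] with ε hε
      exact hwm.mul ((hGm ε hε).aestronglyMeasurable (measurableSet_cube N)))
    (by
      obtain ⟨K', hK'⟩ := (isCompact_cube N).exists_bound_of_continuousOn (hGm 0 h0)
      refine (integrableOn_weight N hβ ha hb).mul_bdd (c := K')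
        ((hGm 0 h0).aestronglyMeasurable (measurableSet_cube N)) ?_
      filter_upwards [ae_restrict_mem (measurableSet_cube N)] with x hx
      exact hK' x hx)
    (by
      refine hwm.mul (ContinuousOn.aestronglyMeasurable ?_ (measurableSet_cube N))
      have : ContinuousOn (fun x => fderiv ℝ G ((0 : ℝ), x)) (cube N) :=
        hcd.comp (by fun_prop) fun x hx => hsub ⟨h0, hx⟩
      exact this.clm_apply continuousOn_const)
    (by
      filter_upwards [ae_restrict_mem (measurableSet_cube N)] with x hx ε hε
      rw [norm_mul, Real.norm_of_nonneg (weight_nonneg β a b hx)]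
      refine mul_le_mul_of_nonneg_left ?_ (weight_nonneg β a b hx)
      exact (ContinuousLinearMap.le_opNorm _ _).trans
        (mul_le_mul_of_nonneg_right (hK (ε, x) ⟨hε, hx⟩) (norm_nonneg _)))
    ((integrableOn_weight N hβ ha hb).mul_const _)
    (by
      filter_upwards [ae_restrict_mem (measurableSet_cube N)] with x hx ε hε
      exact (hder ε hε x hx).const_mul _)
  have hzero : HasDerivAt (fun ε => ∫ x in cube N, weight N β a b x * G (ε, x)) 0 0 := by
    refine (hasDerivAt_const (0 : ℝ) (∫ x in cube N, weight N β a b x * g x)).congr_of_eventuallyEq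
      ?_
    filter_upwards [hmem] with ε hε
    exact hconst ε hε
  have hfin := hI.2.unique hzero
  rw [← hfin]
  refine setIntegral_congr_fun (measurableSet_cube N) fun x hx => ?_
  congr 1
  have hd := (hasDerivAt_flowRatio β a b f' u v q x).mul
    (hasDerivAt_comp_flow f x (hg.differentiable one_ne_zero x))
  have hd' := hder 0 h0 x hx
  have := hd.unique hd'
  rw [← this]
  have e0 : flow f 0 x = x := by
    ext i
    simp [flow]
  simp [e0, flowRatio]

/-- The loop equation of the beta Jacobi ensemble. -/
theorem IsBoundaryField.integral_loop (hf : IsBoundaryField f f' u v q) {N : ℕ} {β a b : ℝ}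
    (hβ : 0 < β) (ha : -1 < a) (hb : -1 < b) {g : (Fin N → ℝ) → ℝ} (hg : ContDiff ℝ 1 g) :
    ∫ x, (loopTerm β a b f' u v q x * g x + fderiv ℝ g x fun i => f (x i)) ∂(ensemble N β a b)
      = 0 := by
  rw [integral_ensemble N hβ ha hb, hf.setIntegral_loop hβ ha hb hg, mul_zero]

end

/-! ### Power means and the loop equation for polynomial fields -/

/-- `∑_{i < n} xⁱ y^{n - 1 - i} = (xⁿ - yⁿ) / (x - y)`. -/
def geomDiff (n : ℕ) (x y : ℝ) : ℝ := ∑ i ∈ Finset.range n, x ^ i * y ^ (n - 1 - i)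

theorem geomDiff_comm (n : ℕ) (x y : ℝ) : geomDiff n x y = geomDiff n y x := by
  unfold geomDiff
  rw [← Finset.sum_range_reflect]
  refine Finset.sum_congr rfl fun i hi => ?_
  have : n - 1 - (n - 1 - i) = i := by
    have := Finset.mem_range.1 hi
    omega
  rw [this, mul_comm]

theorem geomDiff_self (n : ℕ) (x : ℝ) : geomDiff n x x = n * x ^ (n - 1) := by
  unfold geomDiff
  rw [Finset.sum_congr rfl fun i hi => (by
    rw [← pow_add]
    congr 1
    have := Finset.mem_range.1 hi
    omega : x ^ i * x ^ (n - 1 - i) = x ^ (n - 1))]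
  simp

theorem isBoundaryField_pow (k : ℕ) :
    IsBoundaryField (fun x => x ^ (k + 1) * (1 - x))
      (fun x => (k + 1) * x ^ k - (k + 2) * x ^ (k + 1)) (fun x => x ^ k * (1 - x))
      (fun x => x ^ (k + 1)) (fun x y => geomDiff (k + 1) x y - geomDiff (k + 2) x y) where
  hasDerivAt x := by
    have h := (hasDerivAt_pow (k + 1) x).mul ((hasDerivAt_id x).const_sub 1)
    refine h.congr_deriv ?_
    simp
    ring
  left x := by ring
  right x := by ring
  diff x y := by
    have h1 := geom_sum₂_mul x y (k + 1)
    have h2 := geom_sum₂_mul x y (k + 2)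
    unfold geomDiff
    linear_combination h2 - h1
  contDiff := by fun_prop
  contDiff_deriv := by fun_prop
  contDiff_left := by fun_prop
  contDiff_right := by fun_prop
  contDiff_diff := by
    unfold geomDiff
    fun_prop

/-- `N⁻¹ ∑ xᵢᵏ`. -/
noncomputable def powerMean (k N : ℕ) (x : Fin N → ℝ) : ℝ := (∑ i, x i ^ k) / N

theorem powerMean_zero {N : ℕ} (hN : 0 < N) (x : Fin N → ℝ) : powerMean 0 N x = 1 := by
  have : (N : ℝ) ≠ 0 := by positivity
  simp [powerMean, this]

theorem sum_pow_eq {N : ℕ} (hN : 0 < N) (k : ℕ) (x : Fin N → ℝ) :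
    ∑ i, x i ^ k = N * powerMean k N x := by
  have : (N : ℝ) ≠ 0 := by positivity
  rw [powerMean, mul_div_cancel₀ _ this]

/-- The quantity that the loop equation for the field `x^{k+1} (1 - x)` makes small. -/
noncomputable def loopMean (β a b : ℝ) (k N : ℕ) (x : Fin N → ℝ) : ℝ :=
  (k + 1 + a) * powerMean k N x - (k + 2 + a + b) * powerMean (k + 1) N x
    + β * N / 2 * (∑ l ∈ Finset.range (k + 1), powerMean l N x * powerMean (k - l) N x
      - ∑ l ∈ Finset.range (k + 2), powerMean l N x * powerMean (k + 1 - l) N x)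
    - β / 2 * ((k + 1) * powerMean k N x - (k + 2) * powerMean (k + 1) N x)

theorem sum_sum_geomDiff {N : ℕ} (hN : 0 < N) (n : ℕ) (x : Fin N → ℝ) :
    ∑ i, ∑ j, geomDiff n (x j) (x i)
      = N ^ 2 * ∑ l ∈ Finset.range n, powerMean l N x * powerMean (n - 1 - l) N x := by
  unfold geomDiff
  have h : ∀ i : Fin N, ∑ j, ∑ l ∈ Finset.range n, x j ^ l * x i ^ (n - 1 - l)
      = ∑ l ∈ Finset.range n, (∑ j, x j ^ l) * x i ^ (n - 1 - l) := by
    intro i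
    rw [Finset.sum_comm]
    exact Finset.sum_congr rfl fun l _ => (Finset.sum_mul _ _ _).symm
  rw [Finset.sum_congr rfl fun i _ => h i, Finset.sum_comm, Finset.mul_sum]
  refine Finset.sum_congr rfl fun l _ => ?_
  rw [← Finset.mul_sum, sum_pow_eq hN, sum_pow_eq hN]
  ring

/-- Symmetrizing the sum over pairs costs the diagonal, which produces the last term of `loopMean`;
it carries a factor `β` without `N` and disappears in the limit. -/
theorem sum_Ioi_geomDiff {N : ℕ} (n : ℕ) (x : Fin N → ℝ) :
    2 * ∑ i, ∑ j ∈ Finset.Ioi i, geomDiff n (x j) (x i)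
      = ∑ i, ∑ j, geomDiff n (x j) (x i) - ∑ i, n * x i ^ (n - 1) := by
  have h := Finset.sum_sum_Ioi_add_eq_sum_sum_off_diag (fun i j : Fin N => geomDiff n (x i) (x j))
  have h1 : ∀ i : Fin N, ∑ j ∈ {i}ᶜ, geomDiff n (x j) (x i)
      = ∑ j, geomDiff n (x j) (x i) - n * x i ^ (n - 1) := by
    intro i
    rw [← Finset.sum_compl_add_sum {i}, Finset.sum_singleton, geomDiff_self]
    ring
  simp_rw [h1, Finset.sum_sub_distrib] at h
  rw [← h, Finset.mul_sum]
  refine Finset.sum_congr rfl fun i _ => ?_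
  rw [Finset.mul_sum]
  refine Finset.sum_congr rfl fun j _ => ?_
  rw [geomDiff_comm n (x i) (x j)]
  ring

theorem loopTerm_pow {N : ℕ} (hN : 0 < N) (β a b : ℝ) (k : ℕ) (x : Fin N → ℝ) :
    loopTerm β a b (fun x => (k + 1) * x ^ k - (k + 2) * x ^ (k + 1)) (fun x => x ^ k * (1 - x))
      (fun x => x ^ (k + 1)) (fun x y => geomDiff (k + 1) x y - geomDiff (k + 2) x y) x
      = N * loopMean β a b k N x := by
  have e1 := sum_Ioi_geomDiff (k + 1) x
  have e2 := sum_Ioi_geomDiff (k + 2) x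
  rw [sum_sum_geomDiff hN] at e1 e2
  simp only [← Finset.mul_sum, Nat.add_sub_cancel] at e1 e2
  have e3 : k + 2 - 1 = k + 1 := rfl
  rw [e3] at e2
  rw [sum_pow_eq hN] at e1 e2
  have e4 : ∀ l : Fin N, a * (x l ^ k * (1 - x l)) - b * x l ^ (k + 1)
      = a * x l ^ k - (a + b) * x l ^ (k + 1) := fun l => by ring
  simp only [loopTerm, e4]
  simp only [Finset.sum_sub_distrib, ← Finset.mul_sum, mul_sub]
  rw [sum_pow_eq hN, sum_pow_eq hN]
  unfold loopMean
  push_cast at e1 e2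
  linear_combination β / 2 * e1 - β / 2 * e2

/-! ### Tame families of functions of configurations -/

/-- A family of `C¹` functions on configurations of `N` points, bounded on the cubes with bounded
derivatives, uniformly in `N`. -/
def Tame (Q : ∀ N : ℕ, (Fin N → ℝ) → ℝ) : Prop :=
  (∀ N, ContDiff ℝ 1 (Q N)) ∧
    ∃ C : ℝ, ∀ N, ∀ x ∈ cube N, |Q N x| ≤ C ∧ ‖fderiv ℝ (Q N) x‖ ≤ C

theorem Tame.differentiableAt {Q : ∀ N : ℕ, (Fin N → ℝ) → ℝ} (hQ : Tame Q) (N : ℕ)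
    (x : Fin N → ℝ) : DifferentiableAt ℝ (Q N) x := (hQ.1 N).differentiable one_ne_zero x

theorem Tame.add {Q R : ∀ N : ℕ, (Fin N → ℝ) → ℝ} (hQ : Tame Q) (hR : Tame R) :
    Tame fun N x => Q N x + R N x := by
  have dQ := hQ.differentiableAt
  have dR := hR.differentiableAt
  obtain ⟨cQ, C, hC⟩ := hQ
  obtain ⟨cR, D, hD⟩ := hR
  refine ⟨fun N => (cQ N).add (cR N), C + D, fun N x hx => ⟨?_, ?_⟩⟩
  · exact (abs_add_le _ _).trans (add_le_add (hC N x hx).1 (hD N x hx).1)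
  · rw [fderiv_fun_add (dQ N x) (dR N x)]
    exact (norm_add_le _ _).trans (add_le_add (hC N x hx).2 (hD N x hx).2)

theorem Tame.mul {Q R : ∀ N : ℕ, (Fin N → ℝ) → ℝ} (hQ : Tame Q) (hR : Tame R) :
    Tame fun N x => Q N x * R N x := by
  have dQ := hQ.differentiableAt
  have dR := hR.differentiableAt
  obtain ⟨cQ, C, hC⟩ := hQ
  obtain ⟨cR, D, hD⟩ := hR
  refine ⟨fun N => (cQ N).mul (cR N), C * D + C * D, fun N x hx => ?_⟩
  have hC0 : 0 ≤ C := (abs_nonneg _).trans (hC N x hx).1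
  have hD0 : 0 ≤ D := (abs_nonneg _).trans (hD N x hx).1
  constructor
  · rw [abs_mul]
    have := mul_le_mul (hC N x hx).1 (hD N x hx).1 (abs_nonneg _) hC0
    nlinarith [mul_nonneg hC0 hD0]
  · rw [fderiv_fun_mul (dQ N x) (dR N x)]
    refine (norm_add_le _ _).trans (add_le_add ?_ ?_)
    · rw [norm_smul]
      exact mul_le_mul (hC N x hx).1 (hD N x hx).2 (norm_nonneg _) hC0
    · rw [norm_smul, mul_comm]
      exact mul_le_mul (hC N x hx).2 (hD N x hx).1 (norm_nonneg _) hC0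

theorem Tame.const {r : ℕ → ℝ} {R : ℝ} (hr : ∀ N, |r N| ≤ R) : Tame fun N _ => r N := by
  refine ⟨fun N => contDiff_const, R, fun N x _ => ⟨hr N, ?_⟩⟩
  rw [fderiv_fun_const]
  simpa using (abs_nonneg _).trans (hr N)

theorem Tame.sum {ι : Type*} (s : Finset ι) {Q : ι → ∀ N : ℕ, (Fin N → ℝ) → ℝ}
    (hQ : ∀ i ∈ s, Tame (Q i)) : Tame fun N x => ∑ i ∈ s, Q i N x := by
  classical
  induction s using Finset.induction_on with
  | empty => simpa using Tame.const (r := fun _ => 0) (R := 0) (by simp)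
  | insert i s hi ih =>
    simp only [Finset.sum_insert hi]
    exact (hQ i (Finset.mem_insert_self i s)).add
      (ih fun j hj => hQ j (Finset.mem_insert_of_mem hj))

/-- Configurations carry the sup norm, so the norm of the derivative is at most the sum of `N`
partial derivatives, each at most `k / N` in absolute value: a bound free of `N`. -/
theorem tame_powerMean (k : ℕ) : Tame (powerMean k) := by
  refine ⟨fun N => ?_, max 1 k, fun N x hx => ?_⟩
  · unfold powerMean
    fun_prop
  rw [mem_cube] at hx
  rcases Nat.eq_zero_or_pos N with rfl | hN
  · have e : powerMean k 0 = fun _ => 0 := by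
      ext y
      simp [powerMean]
    rw [e]
    simp
  have hN' : (0 : ℝ) < N := by positivity
  constructor
  · refine le_trans ?_ (le_max_left _ _)
    rw [powerMean, abs_div, abs_of_pos hN', div_le_one hN']
    refine (Finset.abs_sum_le_sum_abs _ _).trans ?_
    refine (Finset.sum_le_card_nsmul _ _ 1 fun i _ => ?_).trans (by simp)
    rw [abs_of_nonneg (pow_nonneg (hx i).1 k)]
    exact pow_le_one₀ (hx i).1 (hx i).2
  · refine le_trans ?_ (le_max_right _ _)
    have h : HasFDerivAt (powerMean k N) (∑ i, ((k * x i ^ (k - 1)) / N)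
        • (ContinuousLinearMap.proj (R := ℝ) (φ := fun _ : Fin N => ℝ) i)) x := by
      have h1 : HasFDerivAt (fun y : Fin N → ℝ => (N : ℝ)⁻¹ * ∑ i, y i ^ k)
          ((N : ℝ)⁻¹ • ∑ i, (k * x i ^ (k - 1))
            • (ContinuousLinearMap.proj (R := ℝ) (φ := fun _ : Fin N => ℝ) i)) x := by
        refine HasFDerivAt.const_mul (HasFDerivAt.fun_sum fun i _ => ?_) _
        exact (hasDerivAt_pow k (x i)).comp_hasFDerivAt x
          (ContinuousLinearMap.proj (R := ℝ) (φ := fun _ : Fin N => ℝ) i).hasFDerivAt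
      have e : powerMean k N = fun y : Fin N → ℝ => (N : ℝ)⁻¹ * ∑ i, y i ^ k := by
        ext y
        rw [powerMean, div_eq_inv_mul]
      rw [e]
      refine h1.congr_fderiv ?_
      rw [Finset.smul_sum]
      refine Finset.sum_congr rfl fun i _ => ?_
      rw [smul_smul, div_eq_inv_mul]
    rw [h.fderiv]
    refine (norm_sum_le _ _).trans ((Finset.sum_le_card_nsmul _ _ ((k : ℝ) / N)
      fun i _ => ?_).trans ?_)
    · rw [norm_smul]
      have hp : ‖(ContinuousLinearMap.proj (R := ℝ) (φ := fun _ : Fin N => ℝ) i)‖ ≤ 1 :=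
        ContinuousLinearMap.opNorm_le_bound _ zero_le_one fun w => by
          rw [one_mul]
          exact norm_le_pi_norm w i
      have h2 : 0 ≤ x i ^ (k - 1) := pow_nonneg (hx i).1 _
      have h3 : x i ^ (k - 1) ≤ 1 := pow_le_one₀ (hx i).1 (hx i).2
      rw [Real.norm_of_nonneg (by positivity)]
      calc k * x i ^ (k - 1) / N * _ ≤ k * x i ^ (k - 1) / N * 1 := by gcongr
        _ ≤ k * 1 / N := by rw [mul_one]; gcongr
        _ = k / N := by rw [mul_one]
    · simp only [Finset.card_univ, Fintype.card_fin, nsmul_eq_mul]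
      rw [mul_div_cancel₀ _ hN'.ne']

/-! ### Convergence of the power means -/

theorem Tame.const_mul {Q : ∀ N : ℕ, (Fin N → ℝ) → ℝ} (hQ : Tame Q) {r : ℕ → ℝ} {R : ℝ}
    (hr : ∀ N, |r N| ≤ R) : Tame fun N x => r N * Q N x := (Tame.const hr).mul hQ

theorem Tame.sub {Q R : ∀ N : ℕ, (Fin N → ℝ) → ℝ} (hQ : Tame Q) (hR : Tame R) :
    Tame fun N x => Q N x - R N x := by
  have h := hQ.add (hR.const_mul (r := fun _ => -1) (R := 1) (by simp))
  simpa only [neg_one_mul, ← sub_eq_add_neg] using h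

theorem exists_abs_le_of_tendsto {r : ℕ → ℝ} {y : ℝ} (hr : Tendsto r atTop (𝓝 y)) :
    ∃ R, ∀ N, |r N| ≤ R := by
  obtain ⟨R, hR⟩ := (Metric.isBounded_range_of_tendsto r hr).exists_norm_le
  exact ⟨R, fun N => hR _ ⟨N, rfl⟩⟩

theorem tame_loopMean {β : ℕ → ℝ} (a b : ℝ) {y z : ℝ} (hβ : Tendsto β atTop (𝓝 y))
    (hβN : Tendsto (fun N : ℕ => β N * (N : ℝ)) atTop (𝓝 z)) (k : ℕ) :
    Tame fun N x => loopMean (β N) a b k N x := by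
  obtain ⟨R₁, h₁⟩ := exists_abs_le_of_tendsto (hβ.div_const 2)
  obtain ⟨R₂, h₂⟩ := exists_abs_le_of_tendsto (hβN.div_const 2)
  have hc : ∀ (r : ℝ) (k : ℕ), Tame fun N x => r * powerMean k N x := fun r k =>
    (tame_powerMean k).const_mul (r := fun _ => r) fun _ => le_rfl
  have hs : ∀ n m, Tame fun N x => ∑ l ∈ Finset.range n, powerMean l N x
      * powerMean (m - l) N x := fun n m =>
    Tame.sum _ fun l _ => (tame_powerMean l).mul (tame_powerMean (m - l))
  exact (((hc _ _).sub (hc _ _)).add (((hs _ _).sub (hs _ _)).const_mul h₂)).sub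
    (((hc _ _).sub (hc _ _)).const_mul h₁)

section

variable {a b : ℝ} {β : ℕ → ℝ}

theorem integrable_of_cube_bound {N : ℕ} {β a b : ℝ} (hβ : 0 < β) (ha : -1 < a) (hb : -1 < b)
    {g : (Fin N → ℝ) → ℝ} (hg : Continuous g) {C : ℝ} (hC : ∀ x ∈ cube N, |g x| ≤ C) :
    Integrable g (ensemble N β a b) := by
  have := isProbabilityMeasure_ensemble N hβ ha hb
  refine Integrable.of_bound hg.aestronglyMeasurable C ?_
  filter_upwards [ae_ensemble_mem_cube N β a b] with x hx
  exact hC x hx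

theorem Tame.integrable {Q : ∀ N : ℕ, (Fin N → ℝ) → ℝ} (hQ : Tame Q) (hβ : ∀ N, 0 < β N)
    (ha : -1 < a) (hb : -1 < b) (N : ℕ) : Integrable (Q N) (ensemble N (β N) a b) := by
  obtain ⟨cQ, C, hC⟩ := hQ
  exact integrable_of_cube_bound (hβ N) ha hb (cQ N).continuous fun x hx => (hC N x hx).1

theorem Tame.integrable_abs_sub {Q : ∀ N : ℕ, (Fin N → ℝ) → ℝ} (hQ : Tame Q)
    (hβ : ∀ N, 0 < β N) (ha : -1 < a) (hb : -1 < b) (y : ℝ) (N : ℕ) :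
    Integrable (fun x => |Q N x - y|) (ensemble N (β N) a b) :=
  ((hQ.sub (Tame.const (r := fun _ => y) fun _ => le_rfl)).integrable hβ ha hb N).abs

/-- `Q` converges to the constant `y` in mean under the ensembles. -/
def MeanConverges (a b : ℝ) (β : ℕ → ℝ) (Q : (N : ℕ) → (Fin N → ℝ) → ℝ) (y : ℝ) : Prop :=
  Tame Q ∧ Tendsto (fun N => ∫ x, |Q N x - y| ∂(ensemble N (β N) a b)) atTop (𝓝 0)

theorem meanConverges_of_le {Q : ∀ N : ℕ, (Fin N → ℝ) → ℝ} {y : ℝ} (hQ : Tame Q) {B : ℕ → ℝ}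
    (hB : Tendsto B atTop (𝓝 0))
    (h : ∀ᶠ N in atTop, ∫ x, |Q N x - y| ∂(ensemble N (β N) a b) ≤ B N) :
    MeanConverges a b β Q y :=
  ⟨hQ, tendsto_of_tendsto_of_tendsto_of_le_of_le' tendsto_const_nhds hB
    (Eventually.of_forall fun _ => integral_nonneg fun _ => abs_nonneg _) h⟩

theorem MeanConverges.add (ha : -1 < a) (hb : -1 < b) (hβ : ∀ N, 0 < β N)
    {Q R : ∀ N : ℕ, (Fin N → ℝ) → ℝ} {y z : ℝ}
    (hQ : MeanConverges a b β Q y) (hR : MeanConverges a b β R z) :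
    MeanConverges a b β (fun N x => Q N x + R N x) (y + z) := by
  have iQ := hQ.1.integrable_abs_sub hβ ha hb y
  have iR := hR.1.integrable_abs_sub hβ ha hb z
  refine meanConverges_of_le (hQ.1.add hR.1) (by simpa using hQ.2.add hR.2)
    (Eventually.of_forall fun N => ?_)
  rw [← integral_add (iQ N) (iR N)]
  refine integral_mono ((hQ.1.add hR.1).integrable_abs_sub hβ ha hb _ N) ((iQ N).add (iR N))
    fun x => ?_
  have e : Q N x + R N x - (y + z) = (Q N x - y) + (R N x - z) := by ring
  simp only [e]
  exact abs_add_le _ _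

/-- The error splits as `(Q - y) * R + y * (R - z)`; the uniform bound on `R` from tameness is what
makes mean convergence multiplicative. -/
theorem MeanConverges.mul (ha : -1 < a) (hb : -1 < b) (hβ : ∀ N, 0 < β N)
    {Q R : ∀ N : ℕ, (Fin N → ℝ) → ℝ} {y z : ℝ}
    (hQ : MeanConverges a b β Q y) (hR : MeanConverges a b β R z) :
    MeanConverges a b β (fun N x => Q N x * R N x) (y * z) := by
  have iQ := hQ.1.integrable_abs_sub hβ ha hb y
  have iR := hR.1.integrable_abs_sub hβ ha hb z
  obtain ⟨C, hC⟩ := hR.1.2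
  refine meanConverges_of_le (hQ.1.mul hR.1)
    (by simpa using (hQ.2.const_mul C).add (hR.2.const_mul |y|)) (Eventually.of_forall fun N => ?_)
  rw [← integral_const_mul, ← integral_const_mul,
    ← integral_add ((iQ N).const_mul _) ((iR N).const_mul _)]
  refine integral_mono_ae ((hQ.1.mul hR.1).integrable_abs_sub hβ ha hb _ N)
    (((iQ N).const_mul _).add ((iR N).const_mul _)) ?_
  filter_upwards [ae_ensemble_mem_cube N (β N) a b] with x hx
  have e : Q N x * R N x - y * z = (Q N x - y) * R N x + y * (R N x - z) := by ring
  simp only [e]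
  refine (abs_add_le _ _).trans (add_le_add ?_ ?_)
  · rw [abs_mul, mul_comm]
    exact mul_le_mul_of_nonneg_right (hC N x hx).1 (abs_nonneg _)
  · rw [abs_mul]

theorem MeanConverges.const (ha : -1 < a) (hb : -1 < b) (hβ : ∀ N, 0 < β N) {r : ℕ → ℝ} {y : ℝ}
    (hr : Tendsto r atTop (𝓝 y)) : MeanConverges a b β (fun N _ => r N) y := by
  obtain ⟨R, hR⟩ := exists_abs_le_of_tendsto hr
  refine meanConverges_of_le (Tame.const hR)
    (B := fun N => |r N - y|) (by simpa using (hr.sub_const y).abs)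
    (Eventually.of_forall fun N => ?_)
  have := isProbabilityMeasure_ensemble N (hβ N) ha hb
  simp

theorem MeanConverges.const_mul (ha : -1 < a) (hb : -1 < b) (hβ : ∀ N, 0 < β N)
    {Q : ∀ N : ℕ, (Fin N → ℝ) → ℝ} {y : ℝ} (hQ : MeanConverges a b β Q y) {r : ℕ → ℝ} {s : ℝ}
    (hr : Tendsto r atTop (𝓝 s)) : MeanConverges a b β (fun N x => r N * Q N x) (s * y) :=
  (MeanConverges.const ha hb hβ hr).mul ha hb hβ hQ

theorem MeanConverges.sub (ha : -1 < a) (hb : -1 < b) (hβ : ∀ N, 0 < β N)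
    {Q R : ∀ N : ℕ, (Fin N → ℝ) → ℝ} {y z : ℝ}
    (hQ : MeanConverges a b β Q y) (hR : MeanConverges a b β R z) :
    MeanConverges a b β (fun N x => Q N x - R N x) (y - z) := by
  have h := hQ.add ha hb hβ (hR.const_mul ha hb hβ (r := fun _ => -1) tendsto_const_nhds)
  simpa only [neg_one_mul, ← sub_eq_add_neg] using h

theorem MeanConverges.sum (ha : -1 < a) (hb : -1 < b) (hβ : ∀ N, 0 < β N)
    {ι : Type*} (s : Finset ι) {Q : ι → ∀ N : ℕ, (Fin N → ℝ) → ℝ} {y : ι → ℝ}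
    (hQ : ∀ i ∈ s, MeanConverges a b β (Q i) (y i)) :
    MeanConverges a b β (fun N x => ∑ i ∈ s, Q i N x) (∑ i ∈ s, y i) := by
  classical
  induction s using Finset.induction_on with
  | empty =>
    simpa using MeanConverges.const ha hb hβ (tendsto_const_nhds (x := (0 : ℝ)) (f := atTop))
  | insert i s hi ih =>
    simp only [Finset.sum_insert hi]
    exact (hQ i (Finset.mem_insert_self i s)).add ha hb hβ
      (ih fun j hj => hQ j (Finset.mem_insert_of_mem hj))

theorem MeanConverges.congr {Q R : ∀ N : ℕ, (Fin N → ℝ) → ℝ} {y : ℝ}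
    (hQ : MeanConverges a b β Q y) (hR : Tame R) (h : ∀ᶠ N in atTop, Q N = R N) :
    MeanConverges a b β R y := by
  refine ⟨hR, hQ.2.congr' ?_⟩
  filter_upwards [h] with N hN
  rw [hN]

/-- Mean square convergence implies convergence in mean. -/
theorem meanConverges_zero_of_sq (ha : -1 < a) (hb : -1 < b) (hβ : ∀ N, 0 < β N)
    {Q : ∀ N : ℕ, (Fin N → ℝ) → ℝ} (hQ : Tame Q)
    (h : Tendsto (fun N => ∫ x, Q N x * Q N x ∂(ensemble N (β N) a b)) atTop (𝓝 0)) :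
    MeanConverges a b β Q 0 := by
  refine meanConverges_of_le hQ (by simpa using h.sqrt) (Eventually.of_forall fun N => ?_)
  have := isProbabilityMeasure_ensemble N (hβ N) ha hb
  simp only [sub_zero]
  have i1 : Integrable (fun x => |Q N x|) (ensemble N (β N) a b) :=
    (hQ.integrable hβ ha hb N).abs
  have i2 := (hQ.mul hQ).integrable hβ ha hb N
  set m := ∫ x, |Q N x| ∂(ensemble N (β N) a b) with hm
  refine Real.le_sqrt_of_sq_le ?_
  -- Nonnegativity of the variance of `|Q|`, which gives `m ^ 2 ≤ E[Q^2]`.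
  have h0 : 0 ≤ ∫ x, (Q N x * Q N x - 2 * m * |Q N x| + m ^ 2) ∂(ensemble N (β N) a b) := by
    refine integral_nonneg fun x => ?_
    have e : Q N x * Q N x - 2 * m * |Q N x| + m ^ 2 = (|Q N x| - m) ^ 2 := by
      rw [sub_sq, sq_abs]
      ring
    simp only [e]
    positivity
  rw [integral_add (by exact i2.sub (i1.const_mul _)) (integrable_const _), integral_sub i2
    (i1.const_mul _), integral_const_mul, ← hm] at h0
  simp only [integral_const, probReal_univ, one_smul] at h0
  linarith [h0]

theorem tendsto_zero_of_mul_natCast {z : ℝ}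
    (hβN : Tendsto (fun N : ℕ => β N * (N : ℝ)) atTop (𝓝 z)) : Tendsto β atTop (𝓝 0) := by
  refine (hβN.div_atTop tendsto_natCast_atTop_atTop).congr' ?_
  filter_upwards [eventually_gt_atTop 0] with N hN
  have : (N : ℝ) ≠ 0 := by positivity
  field_simp

/-- The loop equation is tested against `loopMean` itself. The term `N * E[L^2]` is then balanced by
the derivative of `L` along the field, which tameness bounds by a constant, so `E[L^2]` is at most
`C / N`. -/
theorem meanConverges_loopMean (ha : -1 < a) (hb : -1 < b) (hβ : ∀ N, 0 < β N) {z : ℝ}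
    (hβN : Tendsto (fun N : ℕ => β N * (N : ℝ)) atTop (𝓝 z)) (k : ℕ) :
    MeanConverges a b β (fun N x => loopMean (β N) a b k N x) 0 := by
  have hT := tame_loopMean a b (tendsto_zero_of_mul_natCast hβN) hβN k
  refine meanConverges_zero_of_sq ha hb hβ hT ?_
  obtain ⟨C, hC⟩ := hT.2
  refine squeeze_zero_norm' (a := fun N : ℕ => C / N) ?_
    (tendsto_const_div_atTop_nhds_zero_nat C)
  filter_upwards [eventually_gt_atTop 0] with N hN
  have hN' : (0 : ℝ) < N := by positivity
  have := isProbabilityMeasure_ensemble N (hβ N) ha hb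
  have hl := (isBoundaryField_pow k).integral_loop (hβ N) ha hb (hT.1 N)
  simp only [loopTerm_pow hN] at hl
  set D : (Fin N → ℝ) → ℝ := fun x => fderiv ℝ (fun x => loopMean (β N) a b k N x) x
    fun i => x i ^ (k + 1) * (1 - x i) with hD
  have hDb : ∀ x ∈ cube N, |D x| ≤ C := by
    intro x hx
    have hC0 : 0 ≤ C := (abs_nonneg _).trans (hC N x hx).1
    refine (ContinuousLinearMap.le_opNorm (fderiv ℝ (fun x => loopMean (β N) a b k N x) x)
      _).trans ?_
    have hw : ‖fun i => x i ^ (k + 1) * (1 - x i)‖ ≤ 1 := by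
      rw [pi_norm_le_iff_of_nonneg zero_le_one]
      intro i
      have hi := mem_cube.1 hx i
      have h1 : 0 ≤ x i ^ (k + 1) := pow_nonneg hi.1 _
      have h2 : x i ^ (k + 1) ≤ 1 := pow_le_one₀ hi.1 hi.2
      rw [Real.norm_of_nonneg (mul_nonneg h1 (by linarith))]
      exact mul_le_one₀ h2 (by linarith) (by linarith)
    calc _ ≤ C * 1 := mul_le_mul (hC N x hx).2 hw (norm_nonneg _) hC0
      _ = C := mul_one C
  have hDc : Continuous D := by
    have h1 := (hT.1 N).continuous_fderiv one_ne_zero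
    exact h1.clm_apply (by fun_prop)
  have hDi := integrable_of_cube_bound (hβ N) ha hb hDc hDb
  have i2 := (hT.mul hT).integrable hβ ha hb N
  have e : ∀ x, N * loopMean (β N) a b k N x * loopMean (β N) a b k N x + D x
      = N * (loopMean (β N) a b k N x * loopMean (β N) a b k N x) + D x := fun x => by ring
  have hl' : ∫ x, (N * (loopMean (β N) a b k N x * loopMean (β N) a b k N x) + D x)
      ∂(ensemble N (β N) a b) = 0 := by
    rw [← hl]
    exact integral_congr_ae (ae_of_all _ fun x => (e x).symm)
  rw [integral_add (i2.const_mul _) hDi, integral_const_mul] at hl'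
  have hDn : ‖∫ x, D x ∂(ensemble N (β N) a b)‖ ≤ C := by
    have := norm_integral_le_of_norm_le_const (μ := ensemble N (β N) a b) (f := D) (C := C) (by
      filter_upwards [ae_ensemble_mem_cube N (β N) a b] with x hx
      exact hDb x hx)
    simpa using this
  rw [le_div_iff₀ hN']
  have e2 : (∫ x, loopMean (β N) a b k N x * loopMean (β N) a b k N x ∂(ensemble N (β N) a b)) * N
      = - ∫ x, D x ∂(ensemble N (β N) a b) := by linarith
  rw [← Real.norm_of_nonneg hN'.le, ← norm_mul, e2, norm_neg]
  exact hDn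

/-- The power means of the ensembles converge in mean to the solution of the moment recursion. -/
theorem meanConverges_powerMean (ha : -1 < a) (hb : -1 < b) {c : ℝ} (hc : 0 < c)
    (hβ : ∀ N, 0 < β N) (hβN : Tendsto (fun N : ℕ => β N * (N : ℝ)) atTop (𝓝 (2 * c))) (k : ℕ) :
    MeanConverges a b β (powerMean k) (limitMoment a b c k) := by
  have hβ0 := tendsto_zero_of_mul_natCast hβN
  have hβc : Tendsto (fun N : ℕ => β N * (N : ℝ) / 2) atTop (𝓝 c) := by
    simpa using hβN.div_const 2
  have hβh : Tendsto (fun N : ℕ => β N / 2) atTop (𝓝 0) := by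
    simpa using hβ0.div_const 2
  obtain ⟨hm0, hm⟩ := limitMoment_spec ha hb hc
  induction k using Nat.strong_induction_on with
  | _ k ih =>
    rcases k with _ | k
    · rw [hm0]
      refine (MeanConverges.const ha hb hβ (tendsto_const_nhds (x := (1 : ℝ)))).congr
        (tame_powerMean 0) ?_
      filter_upwards [eventually_gt_atTop 0] with N hN
      ext x
      rw [powerMean_zero hN]
    -- Minus the total coefficient of `powerMean (k + 1)` in `loopMean`. Its limit is positive, so
    -- for large `N` the top power mean can be solved for in terms of `loopMean` and lower ones.
    · set κ : ℕ → ℝ := fun N => k + 2 + a + b + 2 * (β N * N / 2) - β N / 2 * (k + 2) with hκ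
      have hk : (0 : ℝ) ≤ k := Nat.cast_nonneg k
      have hK : (k + 2 + a + b + 2 * c : ℝ) ≠ 0 := by linarith
      have hκt : Tendsto κ atTop (𝓝 (k + 2 + a + b + 2 * c)) := by
        have := ((hβc.const_mul 2).const_add (k + 2 + a + b : ℝ)).sub
          (hβh.mul_const (k + 2 : ℝ))
        simpa using this
      have hκne : ∀ᶠ N in atTop, κ N ≠ 0 := hκt.eventually_ne hK
      have h1 := (ih k (by omega)).const_mul ha hb hβ
        (r := fun N => k + 1 + a - β N / 2 * (k + 1)) (s := k + 1 + a)
        (by simpa using (hβh.mul_const (k + 1 : ℝ)).const_sub (k + 1 + a : ℝ))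
      have h2 := MeanConverges.sum ha hb hβ (Finset.range (k + 1)) (fun l hl =>
        (ih l (Finset.mem_range.1 hl)).mul ha hb hβ (ih (k - l) (by omega)))
      have h3 := MeanConverges.sum ha hb hβ (Finset.range k) (fun l hl =>
        (ih (l + 1) (by have := Finset.mem_range.1 hl; omega)).mul ha hb hβ
          (ih (k - l) (by omega)))
      have h4 := (h1.add ha hb hβ ((h2.sub ha hb hβ h3).const_mul ha hb hβ hβc)).sub ha hb hβ
        (meanConverges_loopMean ha hb hβ hβN k)
      have h5 := h4.const_mul ha hb hβ (hκt.inv₀ hK)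
      have e : limitMoment a b c (k + 1) = (k + 2 + a + b + 2 * c : ℝ)⁻¹
          * ((k + 1 + a) * limitMoment a b c k + c * (∑ l ∈ Finset.range (k + 1),
            limitMoment a b c l * limitMoment a b c (k - l) - ∑ l ∈ Finset.range k,
            limitMoment a b c (l + 1) * limitMoment a b c (k - l)) - 0) := by
        rw [eq_inv_mul_iff_mul_eq₀ hK]
        have h := hm k
        rw [Finset.sum_range_succ _ (k + 1)] at h
        nth_rw 2 [Finset.sum_range_succ'] at h
        simp only [Nat.add_sub_add_right, Nat.sub_self, Nat.sub_zero, hm0] at h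
        linear_combination -h
      rw [e]
      refine h5.congr (tame_powerMean _) ?_
      filter_upwards [eventually_gt_atTop 0, hκne] with N hN hκN
      ext x
      rw [inv_mul_eq_iff_eq_mul₀ hκN]
      have hs : ∑ l ∈ Finset.range (k + 2), powerMean l N x * powerMean (k + 1 - l) N x
          = ∑ l ∈ Finset.range k, powerMean (l + 1) N x * powerMean (k - l) N x
            + 2 * powerMean (k + 1) N x := by
        rw [Finset.sum_range_succ, Finset.sum_range_succ']
        simp only [Nat.add_sub_add_right, Nat.sub_self, Nat.sub_zero, powerMean_zero hN]
        ring
      simp only [loopMean, hκ]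
      rw [hs]
      ring

end

/-! ### Existence and uniqueness of the limiting measure -/

theorem integral_empiricalMeasure {N : ℕ} (x : Fin N → ℝ) (f : ℝ → ℝ) :
    ∫ y, f y ∂(empiricalMeasure x) = (∑ i, f (x i)) / N := by
  rw [empiricalMeasure, integral_smul_measure, integral_finsetSum_measure]
  · simp [div_eq_inv_mul]
  · intro i _
    exact integrable_dirac (by simp)

section

variable {a b c : ℝ} {β : ℕ → ℝ}

theorem measurable_projIcc_apply {N : ℕ} (i : Fin N) :
    Measurable fun x : Fin N → ℝ => Set.projIcc (0 : ℝ) 1 zero_le_one (x i) :=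
  (continuous_projIcc.comp (continuous_apply i)).measurable

/-- The law on `[0,1]` of a uniformly chosen point of the ensemble. -/
noncomputable def meanMeasure (N : ℕ) (β a b : ℝ) : Measure (Set.Icc (0 : ℝ) 1) :=
  (N : ENNReal)⁻¹ • ∑ i : Fin N, (ensemble N β a b).map
    fun x => Set.projIcc (0 : ℝ) 1 zero_le_one (x i)

theorem isProbabilityMeasure_meanMeasure {N : ℕ} (hN : 0 < N) {β : ℝ} (hβ : 0 < β) (ha : -1 < a)
    (hb : -1 < b) : IsProbabilityMeasure (meanMeasure N β a b) := by
  have := isProbabilityMeasure_ensemble N hβ ha hb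
  have h : ∀ i : Fin N, (ensemble N β a b).map
      (fun x => Set.projIcc (0 : ℝ) 1 zero_le_one (x i)) Set.univ = 1 := fun i => by
    rw [Measure.map_apply (measurable_projIcc_apply i)
      MeasurableSet.univ]
    simp
  constructor
  rw [meanMeasure, Measure.smul_apply, Measure.finsetSum_apply, Finset.sum_congr rfl fun i _ => h i]
  simp only [Finset.sum_const, Finset.card_univ, Fintype.card_fin, nsmul_eq_mul, mul_one,
    smul_eq_mul]
  exact ENNReal.inv_mul_cancel (by simpa using hN.ne') (ENNReal.natCast_ne_top N)

theorem integral_pow_meanMeasure {N : ℕ} {β : ℝ} (hβ : 0 < β) (ha : -1 < a) (hb : -1 < b)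
    (k : ℕ) : ∫ y, (y : ℝ) ^ k ∂(meanMeasure N β a b)
      = ∫ x, powerMean k N x ∂(ensemble N β a b) := by
  have := isProbabilityMeasure_ensemble N hβ ha hb
  have hcont : Continuous fun y : Set.Icc (0 : ℝ) 1 => (y : ℝ) ^ k := by fun_prop
  rw [meanMeasure, integral_smul_measure, integral_finsetSum_measure]
  · have h : ∀ i : Fin N, ∫ y, (y : ℝ) ^ k ∂((ensemble N β a b).map
        fun x => Set.projIcc (0 : ℝ) 1 zero_le_one (x i))
        = ∫ x, x i ^ k ∂(ensemble N β a b) := by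
      intro i
      rw [integral_map (measurable_projIcc_apply i).aemeasurable
        hcont.aestronglyMeasurable]
      refine integral_congr_ae ?_
      filter_upwards [ae_ensemble_mem_cube N β a b] with x hx
      rw [Set.projIcc_of_mem zero_le_one (mem_cube.1 hx i)]
    simp_rw [h]
    rw [← integral_finsetSum]
    · simp only [powerMean, integral_div, ENNReal.toReal_inv, ENNReal.toReal_natCast, smul_eq_mul]
      rw [div_eq_inv_mul]
    · intro i _
      refine integrable_of_cube_bound hβ ha hb (by fun_prop) (C := 1) fun x hx => ?_
      have hi := mem_cube.1 hx i
      rw [abs_of_nonneg (pow_nonneg hi.1 k)]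
      exact pow_le_one₀ hi.1 hi.2
  · intro i _
    have : IsFiniteMeasure ((ensemble N β a b).map
      fun x => Set.projIcc (0 : ℝ) 1 zero_le_one (x i)) := inferInstance
    refine Integrable.of_bound hcont.aestronglyMeasurable 1 (ae_of_all _ fun y => ?_)
    rw [Real.norm_of_nonneg (pow_nonneg y.2.1 k)]
    exact pow_le_one₀ y.2.1 y.2.2

theorem tendsto_integral_powerMean (ha : -1 < a) (hb : -1 < b) (hc : 0 < c) (hβ : ∀ N, 0 < β N)
    (hβN : Tendsto (fun N : ℕ => β N * (N : ℝ)) atTop (𝓝 (2 * c))) (k : ℕ) :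
    Tendsto (fun N => ∫ x, powerMean k N x ∂(ensemble N (β N) a b)) atTop
      (𝓝 (limitMoment a b c k)) := by
  obtain ⟨hT, h⟩ := meanConverges_powerMean ha hb hc hβ hβN k
  rw [tendsto_iff_norm_sub_tendsto_zero]
  refine squeeze_zero (fun N => norm_nonneg _) (fun N => ?_) h
  have := isProbabilityMeasure_ensemble N (hβ N) ha hb
  have e : ∫ x, powerMean k N x ∂(ensemble N (β N) a b) - limitMoment a b c k
      = ∫ x, (powerMean k N x - limitMoment a b c k) ∂(ensemble N (β N) a b) := by
    rw [integral_sub (hT.integrable hβ ha hb N) (integrable_const _)]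
    simp
  rw [e]
  exact norm_integral_le_integral_norm _

/-- An admissible choice of inverse temperatures. -/
theorem exists_highTemperature (hc : 0 < c) : ∃ β : ℕ → ℝ, (∀ N, 0 < β N) ∧
    Tendsto (fun N : ℕ => β N * (N : ℝ)) atTop (𝓝 (2 * c)) := by
  -- The value at `N = 0` is set separately because `2 * c / 0 = 0` would violate positivity.
  refine ⟨fun N => if N = 0 then 1 else 2 * c / N, fun N => ?_, ?_⟩
  · rcases Nat.eq_zero_or_pos N with rfl | hN
    · simp
    · simp only [hN.ne', if_false]
      positivity
  · refine tendsto_const_nhds.congr' ?_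
    filter_upwards [eventually_gt_atTop 0] with N hN
    have : (N : ℝ) ≠ 0 := by positivity
    simp only [hN.ne', if_false]
    rw [div_mul_cancel₀ _ this]

/-- The moment problem for `limitMoment` has a solution on `[0,1]`. -/
theorem exists_measure_limitMoment (ha : -1 < a) (hb : -1 < b) (hc : 0 < c) :
    ∃ ν : ProbabilityMeasure ℝ, (ν : Measure ℝ) (Set.Icc 0 1) = 1 ∧
      ∀ k : ℕ, ∫ y, y ^ k ∂(ν : Measure ℝ) = limitMoment a b c k := by
  obtain ⟨β, hβ, hβN⟩ := exists_highTemperature hc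
  -- The index is shifted because the mean measure of zero points has no mass. Probability measures
  -- on the compact interval form a compact space, so this sequence converges along an ultrafilter,
  -- and bounded continuous moments pass to the limit.
  set m : ℕ → ProbabilityMeasure (Set.Icc (0 : ℝ) 1) := fun N =>
    ⟨meanMeasure (N + 1) (β (N + 1)) a b,
      isProbabilityMeasure_meanMeasure N.succ_pos (hβ _) ha hb⟩ with hm
  set U : Ultrafilter (ProbabilityMeasure (Set.Icc (0 : ℝ) 1)) := (hyperfilter ℕ).map m with hU
  have hlim : Tendsto m (hyperfilter ℕ : Filter ℕ) (𝓝 U.lim) := U.le_nhds_lim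
  have hmom : ∀ k : ℕ, ∫ y, (y : ℝ) ^ k ∂(U.lim : Measure (Set.Icc (0 : ℝ) 1))
      = limitMoment a b c k := by
    intro k
    have h1 := (ProbabilityMeasure.tendsto_iff_forall_integral_tendsto.1 hlim)
      (BoundedContinuousFunction.mkOfCompact ⟨fun y : Set.Icc (0 : ℝ) 1 => (y : ℝ) ^ k,
        by fun_prop⟩)
    have h2 := ((tendsto_integral_powerMean ha hb hc hβ hβN k).comp
      (tendsto_add_atTop_nat 1)).mono_left Nat.hyperfilter_le_atTop
    refine tendsto_nhds_unique (h1.congr fun N => ?_) h2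
    exact integral_pow_meanMeasure (hβ (N + 1)) ha hb k
  refine ⟨⟨(U.lim : Measure (Set.Icc (0 : ℝ) 1)).map Subtype.val,
    Measure.isProbabilityMeasure_map measurable_subtype_coe.aemeasurable⟩, ?_, fun k => ?_⟩
  · rw [ProbabilityMeasure.coe_mk, Measure.map_apply measurable_subtype_coe measurableSet_Icc]
    simp
  · rw [ProbabilityMeasure.coe_mk, integral_map measurable_subtype_coe.aemeasurable
      (by fun_prop : Continuous fun y : ℝ => y ^ k).aestronglyMeasurable]
    exact hmom k

theorem integrable_of_Icc {ν : Measure ℝ} [IsProbabilityMeasure ν] (hν : ν (Set.Icc 0 1) = 1)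
    {f : ℝ → ℝ} (hf : Continuous f) : Integrable f ν := by
  obtain ⟨C, hC⟩ := (isCompact_Icc (a := (0 : ℝ)) (b := 1)).exists_bound_of_continuousOn
    hf.continuousOn
  refine Integrable.of_bound hf.aestronglyMeasurable C ?_
  have h : ∀ᵐ y ∂ν, y ∈ Set.Icc (0 : ℝ) 1 := (mem_ae_iff_prob_eq_one measurableSet_Icc).2 hν
  filter_upwards [h] with y hy
  exact hC y hy

theorem isLimitingMeasure_of_moments (ha : -1 < a) (hb : -1 < b) (hc : 0 < c) {ν : Measure ℝ}
    [IsProbabilityMeasure ν] (hν : ν (Set.Icc 0 1) = 1)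
    (hmom : ∀ k : ℕ, ∫ y, y ^ k ∂ν = limitMoment a b c k) : IsLimitingMeasure a b c ν := by
  intro β hβ hβN f ε hε
  have hνae : ∀ᵐ y ∂ν, y ∈ Set.Icc (0 : ℝ) 1 := (mem_ae_iff_prob_eq_one measurableSet_Icc).2 hν
  -- Replacing `f` by `p` costs `ε / 3` in the empirical average and `ε / 3` in the `ν`-average, so
  -- a deviation of size `ε` forces one of size `ε / 3` for the polynomial statistic, which Markov's
  -- inequality controls.
  obtain ⟨p, hp⟩ := exists_polynomial_near_of_continuousOn 0 1 f f.continuous.continuousOn (ε / 3)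
    (by positivity)
  set y : ℝ := ∫ t, p.eval t ∂ν with hy
  have hpy : y = ∑ k ∈ Finset.range (p.natDegree + 1), p.coeff k * limitMoment a b c k := by
    rw [hy]
    simp_rw [Polynomial.eval_eq_sum_range]
    rw [integral_finsetSum _ fun k _ => integrable_of_Icc hν (by fun_prop)]
    exact Finset.sum_congr rfl fun k _ => by rw [integral_const_mul, hmom]
  set Q : ∀ N : ℕ, (Fin N → ℝ) → ℝ := fun N x =>
    ∑ k ∈ Finset.range (p.natDegree + 1), p.coeff k * powerMean k N x with hQ
  have hconv : MeanConverges a b β Q y := by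
    rw [hpy]
    exact MeanConverges.sum ha hb hβ _ fun k _ =>
      (meanConverges_powerMean ha hb hc hβ hβN k).const_mul ha hb hβ
        (r := fun _ => p.coeff k) tendsto_const_nhds
  have hQe : ∀ N (x : Fin N → ℝ), Q N x = (∑ i, p.eval (x i)) / N := by
    intro N x
    simp only [hQ, powerMean, Polynomial.eval_eq_sum_range]
    rw [Finset.sum_comm, Finset.sum_div]
    refine Finset.sum_congr rfl fun k _ => ?_
    rw [← Finset.mul_sum, mul_div_assoc]
  have hfν : |∫ t, f t ∂ν - y| ≤ ε / 3 := by
    rw [hy, ← integral_sub (integrable_of_Icc hν f.continuous)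
      (integrable_of_Icc hν p.continuous)]
    have := norm_integral_le_of_norm_le_const (μ := ν) (f := fun t => f t - p.eval t)
      (C := ε / 3) (by
        filter_upwards [hνae] with t ht
        rw [← norm_neg, neg_sub]
        exact (hp t ht).le)
    simpa using this
  have hbound : ∀ᶠ N in atTop, ensemble N (β N) a b
      {x | ε ≤ |(∫ y, f y ∂(empiricalMeasure x)) - ∫ y, f y ∂ν|}
      ≤ ENNReal.ofReal ((∫ x, |Q N x - y| ∂(ensemble N (β N) a b)) / (ε / 3)) := by
    filter_upwards [eventually_gt_atTop 0] with N hN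
    have hN' : (0 : ℝ) < N := by positivity
    have := isProbabilityMeasure_ensemble N (hβ N) ha hb
    have hsub : ensemble N (β N) a b
        {x | ε ≤ |(∫ y, f y ∂(empiricalMeasure x)) - ∫ y, f y ∂ν|}
        ≤ ensemble N (β N) a b {x | ε / 3 ≤ |Q N x - y|} := by
      refine measure_mono_ae ?_
      filter_upwards [ae_ensemble_mem_cube N (β N) a b] with x hx hxe
      have hxe' : ε ≤ |(∫ y, f y ∂(empiricalMeasure x)) - ∫ y, f y ∂ν| := hxe
      change ε / 3 ≤ |Q N x - y|
      rw [integral_empiricalMeasure] at hxe'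
      have h1 : |(∑ i, f (x i)) / N - Q N x| ≤ ε / 3 := by
        rw [hQe, ← sub_div, ← Finset.sum_sub_distrib, abs_div, abs_of_pos hN', div_le_iff₀ hN']
        refine (Finset.abs_sum_le_sum_abs _ _).trans ((Finset.sum_le_card_nsmul _ _ (ε / 3)
          fun i _ => ?_).trans ?_)
        · rw [abs_sub_comm]
          exact (hp _ (mem_cube.1 hx i)).le
        · simp [mul_comm]
      have h2 : (∑ i, f (x i)) / N - ∫ t, f t ∂ν
          = ((∑ i, f (x i)) / N - Q N x) + (Q N x - y) - (∫ t, f t ∂ν - y) := by ring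
      have h3 := abs_sub (((∑ i, f (x i)) / N - Q N x) + (Q N x - y)) (∫ t, f t ∂ν - y)
      have h4 := abs_add_le ((∑ i, f (x i)) / N - Q N x) (Q N x - y)
      rw [h2] at hxe'
      linarith
    refine hsub.trans ?_
    have hmk := mul_meas_ge_le_integral_of_nonneg (μ := ensemble N (β N) a b)
      (f := fun x => |Q N x - y|) (ae_of_all _ fun x => abs_nonneg _)
      (hconv.1.integrable_abs_sub hβ ha hb y N) (ε / 3)
    rw [← ofReal_measureReal]
    refine ENNReal.ofReal_le_ofReal ?_
    rw [le_div_iff₀ (by positivity), mul_comm]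
    exact hmk
  have hz : Tendsto (fun N => ENNReal.ofReal ((∫ x, |Q N x - y| ∂(ensemble N (β N) a b))
      / (ε / 3))) atTop (𝓝 0) := by
    have := ENNReal.tendsto_ofReal (hconv.2.div_const (ε / 3))
    simpa using this
  exact tendsto_of_tendsto_of_tendsto_of_le_of_le' tendsto_const_nhds hz
    (Eventually.of_forall fun N => zero_le) hbound

theorem IsLimitingMeasure.unique (ha : -1 < a) (hb : -1 < b) (hc : 0 < c) {ν ν' : Measure ℝ}
    [IsProbabilityMeasure ν] [IsProbabilityMeasure ν'] (hν : IsLimitingMeasure a b c ν)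
    (hν' : IsLimitingMeasure a b c ν') : ν = ν' := by
  obtain ⟨β, hβ, hβN⟩ := exists_highTemperature hc
  refine ext_of_forall_integral_eq_of_IsFiniteMeasure fun f => ?_
  by_contra hne
  set ε := |∫ t, f t ∂ν - ∫ t, f t ∂ν'| / 2 with hε
  have hε0 : 0 < ε := by
    have := abs_pos.2 (sub_ne_zero.2 hne)
    positivity
  have h := (hν β hβ hβN f ε hε0).add (hν' β hβ hβN f ε hε0)
  rw [add_zero] at h
  -- As `ε` is half the gap between the two integrals, every configuration is at distance at least
  -- `ε` from one of them; the two probabilities sum to at least `1`, yet both tend to `0`.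
  have h1 : ∀ N, 1 ≤ ensemble N (β N) a b
        {x | ε ≤ |(∫ y, f y ∂(empiricalMeasure x)) - ∫ y, f y ∂ν|}
      + ensemble N (β N) a b
        {x | ε ≤ |(∫ y, f y ∂(empiricalMeasure x)) - ∫ y, f y ∂ν'|} := by
    intro N
    have := isProbabilityMeasure_ensemble N (hβ N) ha hb
    rw [← measure_univ (μ := ensemble N (β N) a b)]
    refine (measure_mono fun x _ => ?_).trans (measure_union_le _ _)
    by_contra hx
    simp only [Set.mem_union, Set.mem_ofPred_eq, not_or, not_le] at hx
    have h3 := abs_sub (∫ y, f y ∂(empiricalMeasure x) - ∫ y, f y ∂ν')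
      (∫ y, f y ∂(empiricalMeasure x) - ∫ y, f y ∂ν)
    have e : (∫ y, f y ∂(empiricalMeasure x) - ∫ y, f y ∂ν')
      - (∫ y, f y ∂(empiricalMeasure x) - ∫ y, f y ∂ν) = ∫ t, f t ∂ν - ∫ t, f t ∂ν' := by ring
    rw [e] at h3
    linarith [hx.1, hx.2]
  have := ge_of_tendsto' h h1
  simp at this

/-! ### The dual measure -/

theorem ZStar_eq_dualMass {ν : Measure ℝ} [IsProbabilityMeasure ν] (hν : ν (Set.Icc 0 1) = 1)
    (hmom : ∀ k : ℕ, ∫ y, y ^ k ∂ν = limitMoment a b c k) : ZStar ν = dualMass a b c := by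
  rw [dualMass, ← hmom 1, ← hmom 2, ZStar, ← integral_sub (integrable_of_Icc hν (by fun_prop))
    (integrable_of_Icc hν (by fun_prop))]
  refine integral_congr_ae (ae_of_all _ fun x => ?_)
  simp only
  ring

theorem integrable_nuStar {ν : Measure ℝ} [IsProbabilityMeasure ν] (hν : ν (Set.Icc 0 1) = 1)
    (hZ : 0 < ZStar ν) {f : ℝ → ℝ} (hf : Continuous f) : Integrable f (nuStar ν) := by
  rw [nuStar]
  refine Integrable.smul_measure ?_ (by simpa using hZ)
  have hm : Measurable fun x : ℝ => ENNReal.ofReal (x * (1 - x)) := by fun_prop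
  rw [integrable_withDensity_iff hm (ae_of_all _ fun x => ENNReal.ofReal_lt_top)]
  simp only [ENNReal.toReal_ofReal']
  exact integrable_of_Icc hν (by fun_prop)

theorem integral_nuStar {ν : Measure ℝ} [IsProbabilityMeasure ν] (hν : ν (Set.Icc 0 1) = 1)
    (hZ : 0 < ZStar ν) (f : ℝ → ℝ) :
    ∫ x, f x ∂(nuStar ν) = (ZStar ν)⁻¹ * ∫ x, x * (1 - x) * f x ∂ν := by
  have hm : Measurable fun x : ℝ => ENNReal.ofReal (x * (1 - x)) := by fun_prop
  have hνae : ∀ᵐ y ∂ν, y ∈ Set.Icc (0 : ℝ) 1 := (mem_ae_iff_prob_eq_one measurableSet_Icc).2 hν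
  rw [nuStar, integral_smul_measure, ENNReal.toReal_inv, ENNReal.toReal_ofReal hZ.le, smul_eq_mul,
    integral_withDensity_eq_integral_toReal_smul hm (ae_of_all _ fun x => ENNReal.ofReal_lt_top)]
  congr 1
  refine integral_congr_ae ?_
  filter_upwards [hνae] with x hx
  rw [ENNReal.toReal_ofReal (mul_nonneg hx.1 (by linarith [hx.2])), smul_eq_mul]

theorem isProbabilityMeasure_nuStar {ν : Measure ℝ} [IsProbabilityMeasure ν]
    (hν : ν (Set.Icc 0 1) = 1) (hZ : 0 < ZStar ν) : IsProbabilityMeasure (nuStar ν) := by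
  have hi := integrable_nuStar hν hZ (continuous_const (y := (1 : ℝ)))
  have hfin : IsFiniteMeasure (nuStar ν) := (integrable_const_iff_isFiniteMeasure one_ne_zero).1 hi
  have h := integral_nuStar hν hZ fun _ => 1
  simp only [mul_one, integral_const, smul_eq_mul] at h
  have h1 : (nuStar ν).real Set.univ = 1 := by
    rw [h]
    exact inv_mul_cancel₀ hZ.ne'
  constructor
  rw [← ofReal_measureReal, h1, ENNReal.ofReal_one]

/-- Since `x * (1 - x) * x^k = x^(k+1) - x^(k+2)`, dual moments are normalized differences of
consecutive moments of `ν`. This is the link between the measure and the algebraic half. -/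
theorem mk_integral_pow_nuStar {ν : Measure ℝ} [IsProbabilityMeasure ν]
    (hν : ν (Set.Icc 0 1) = 1) (hZ : 0 < ZStar ν)
    (hmom : ∀ k : ℕ, ∫ y, y ^ k ∂ν = limitMoment a b c k) :
    PowerSeries.mk (fun k => ∫ x, x ^ k ∂(nuStar ν)) = dualSeries a b c := by
  ext k
  rw [dualSeries, PowerSeries.coeff_mk, PowerSeries.coeff_mk, integral_nuStar hν hZ,
    ZStar_eq_dualMass hν hmom, ← hmom, ← hmom, div_eq_inv_mul,
    ← integral_sub (integrable_of_Icc hν (by fun_prop)) (integrable_of_Icc hν (by fun_prop))]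
  congr 1
  refine integral_congr_ae (ae_of_all _ fun x => ?_)
  simp only
  ring

end

end BetaJacobi

theorem lemma4p2 (a b c : ℝ) (ha : -1 < a) (hb : -1 < b) (hc : 0 < c) :
    (∃! ν : MeasureTheory.ProbabilityMeasure ℝ,
      BetaJacobi.IsLimitingMeasure a b c (ν : MeasureTheory.Measure ℝ)) ∧
    ∀ ν : MeasureTheory.ProbabilityMeasure ℝ,
      BetaJacobi.IsLimitingMeasure a b c (ν : MeasureTheory.Measure ℝ) →
        (ν : MeasureTheory.Measure ℝ) (Set.Icc 0 1) = 1 ∧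
        BetaJacobi.ZStar (ν : MeasureTheory.Measure ℝ) =
          BetaJacobi.lambdaHat0 a b c *
            (1 - BetaJacobi.lambdaHat0 a b c - BetaJacobi.mu a b c 1) ∧
        0 < BetaJacobi.ZStar (ν : MeasureTheory.Measure ℝ) ∧
        MeasureTheory.IsProbabilityMeasure
          (BetaJacobi.nuStar (ν : MeasureTheory.Measure ℝ)) ∧
        BetaJacobi.IsJacobiMatrixOf (BetaJacobi.JStar a b c)
          (BetaJacobi.nuStar (ν : MeasureTheory.Measure ℝ)) := by
  obtain ⟨ν₀, h01, hmom⟩ := BetaJacobi.exists_measure_limitMoment ha hb hc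
  have hlim := BetaJacobi.isLimitingMeasure_of_moments ha hb hc h01 hmom
  have huniq : ∀ ν : MeasureTheory.ProbabilityMeasure ℝ,
      BetaJacobi.IsLimitingMeasure a b c (ν : MeasureTheory.Measure ℝ) → ν = ν₀ :=
    fun ν hν => by
      have h := hν.unique ha hb hc hlim
      exact Subtype.ext h
  refine ⟨⟨ν₀, hlim, huniq⟩, fun ν hν => ?_⟩
  -- Uniqueness transfers the support and the moments known for the constructed measure to an
  -- arbitrary limiting measure.
  obtain rfl := huniq ν hν
  have hZe := BetaJacobi.ZStar_eq_dualMass h01 hmom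
  have hZ : 0 < BetaJacobi.ZStar (ν : MeasureTheory.Measure ℝ) := by
    rw [hZe]
    exact BetaJacobi.dualMass_pos ha hb hc
  exact ⟨h01, hZe.trans (BetaJacobi.dualMass_eq_lambdaHat0 ha hb hc), hZ,
    BetaJacobi.isProbabilityMeasure_nuStar h01 hZ,
    BetaJacobi.isJacobiMatrixOf_JStar ha hb hc
      (fun n => BetaJacobi.integrable_nuStar h01 hZ (by fun_prop))
      (BetaJacobi.mk_integral_pow_nuStar h01 hZ hmom)⟩
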